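/- Let $\mathfrak g=\mathfrak{sl}_2\otimes_{\mathbb C}\mathbb C[x]/(x^2)$ be the Takiff Lie algebra of $\mathfrak{sl}_2$ over $\mathbb C$, with bracket $[a\otimes x^i,b\otimes x^j]=[a,b]\otimes x^{i+j}$. For the standard basis $e,h,f$ of $\mathfrak{sl}_2$ write $a$ for $a\otimes 1$ and $\overline a:=a\otimes x$. Let $\overline{\mathfrak h}=\langle h,\overline h\rangle$, $\overline{\mathfrak n}_+=\langle e,\overline e\rangle$, $\overline{\mathfrak b}=\overline{\mathfrak h}\oplus\overline{\mathfrak n}_+$, and let $\alpha\in\overline{\mathfrak h}^*$ be given by $\alpha(h)=2$, $\alpha(\overline h)=0$. Let $\widetilde{\mathcal O}$ be the full subcategory of $\mathfrak g$-modules consisting of the finitely generated $U(\mathfrak g)$-modules on which $U(\overline{\mathfrak b})$ acts locally finitely, and let $\mathcal O\subset\widetilde{\mathcal O}$ be the full subcategory of those modules on which $h$ acts diagonalizably. For $\lambda\in\overline{\mathfrak h}^*$ let $L(\lambda)$ be the simple quotient of the Verma module $\Delta(\lambda)=U(\mathfrak g)\otimes_{U(\overline{\mathfrak b})}\mathbb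 C_\lambda$, and for a module $M$ in $\widetilde{\mathcal O}$ let $\mathrm{supp}(M)$ be the set of $\lambda\in\overline{\mathfrak h}^*$ for which the generalized weight space $M^\lambda$ is nonzero. Put $\overline{\mathfrak h}^*_1=\{\lambda:\lambda(\overline h)\neq 0\}$ and $\overline{\mathfrak h}^*_0=\{\lambda:\lambda(\overline h)=0\}$. Let $\mathcal X\in\{\mathcal O,\widetilde{\mathcal O}\}$. For $\lambda\in\overline{\mathfrak h}^*_1$ let $\mathcal X(\lambda)$ be the full subcategory of $\mathcal X$ of all modules all of whose simple subquotients are isomorphic to $L(\lambda)$. For $\xi\in\overline{\mathfrak h}^*_0/\mathbb Z\alpha$ let $\mathcal X(\xi)$ be the full subcategory of $\mathcal X$ of all modules whose support is contained in $\xi$. Then $$\mathcal X=\bigoplus_{\lambda\in\overline{\mathfrak h}^*_1}\mathcal X(\lambda)\ \oplus\bigoplus_{\xi\in\overline{\mathfrak h}^*_0/\mathbb Z\alpha}\mathcal X(\xi),$$ and all the summands are abelian subcategories which are indecomposable (nonzero, and not the direct sum of two nonzero full subcategories). Here a direct sum of full subcategories means that there are no nonzero morphisms between objects of different summands and that the objects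 of $\mathcal X$ are, up to isomorphism, exactly the finite direct sums of objects of the summands. Moreover, for $\lambda\in\overline{\mathfrak h}^*_1$, the module $L(\lambda)$ is, up to isomorphism, the only simple object of $\mathcal X(\lambda)$, and every nonzero object of $\mathcal X(\lambda)$ has support $\{\lambda-n\alpha: n\in\mathbb Z_{\ge 0}\}$. -/

import Mathlib

open CategoryTheory CategoryTheory.Limits
open scoped TensorProduct

section DirectSums

universe v u w

variable {C : Type u} [Category.{v} C] [Preadditive C] [HasFiniteBiproducts C]

/-- The full subcategory `X` of `C` is the direct sum of the full subcategories `P i`: there are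
no nonzero morphisms between objects of different `P i`, and the objects of `X` are exactly the
objects isomorphic to a finite direct sum of objects `A i` of `P i`, over finitely many
indices `i`. -/
structure IsDirectSumOfSubcategories (X : ObjectProperty C) {I : Type w}
    (P : I → ObjectProperty C) : Prop where
  hom_eq_zero : ∀ i j : I, i ≠ j → ∀ A B : C, P i A → P j B → ∀ f : A ⟶ B, f = 0
  mem_iff : ∀ M : C, X M ↔ ∃ (s : Finset I) (A : s → C),
    (∀ i : s, P i (A i)) ∧ Nonempty (M ≅ ⨁ A)

/-- A full subcategory is indecomposable if it is nonzero and is not the direct sum of two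
nonzero full subcategories. -/
def IsIndecomposableSubcategory (P : ObjectProperty C) : Prop :=
  (∃ M : C, P M ∧ ¬ IsZero M) ∧
    ∀ Q : Fin 2 → ObjectProperty C, IsDirectSumOfSubcategories P Q →
      ∃ i : Fin 2, ∀ A : C, Q i A → IsZero A

/-- A full subcategory is an abelian subcategory if it contains a zero object and is closed under
isomorphisms, finite direct sums, kernels and cokernels (so that it is abelian and its inclusion
is exact). -/
structure IsAbelianSubcategory (P : ObjectProperty C) : Prop where
  containsZero : P.ContainsZero
  closedUnderIsomorphisms : P.IsClosedUnderIsomorphisms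
  closedUnderFiniteProducts : P.IsClosedUnderFiniteProducts
  closedUnderKernels : P.IsClosedUnderKernels
  closedUnderCokernels : P.IsClosedUnderCokernels

end DirectSums

namespace Takiff

noncomputable section

/-- The Lie algebra `sl₂` over `ℂ`. -/
abbrev SL2 : Type := LieAlgebra.SpecialLinear.sl (Fin 2) ℂ

def slE : SL2 := ⟨!![0, 1; 0, 0], by simp [LieAlgebra.SpecialLinear.sl]⟩

def slF : SL2 := ⟨!![0, 0; 1, 0], by simp [LieAlgebra.SpecialLinear.sl]⟩

def slH : SL2 := ⟨!![1, 0; 0, -1], by simp [LieAlgebra.SpecialLinear.sl]⟩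

/-- The Takiff Lie algebra `𝔤` of `sl₂`: the tensor product of `sl₂` with the dual numbers
`ℂ[x]/(x²)`, with bracket `[a ⊗ xⁱ, b ⊗ xʲ] = [a, b] ⊗ xⁱ⁺ʲ`, as a Lie algebra over `ℂ`. -/
abbrev G : Type := DualNumber ℂ ⊗[ℂ] SL2

def e : G := 1 ⊗ₜ slE

def f : G := 1 ⊗ₜ slF

def h : G := 1 ⊗ₜ slH

def ebar : G := DualNumber.eps ⊗ₜ slE

def fbar : G := DualNumber.eps ⊗ₜ slF

def hbar : G := DualNumber.eps ⊗ₜ slH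

/-- The subalgebra generated by `h` and `hbar`. -/
def cartan : LieSubalgebra ℂ G := LieSubalgebra.lieSpan ℂ G {h, hbar}

/-- The subalgebra generated by `e` and `ebar`. -/
def nPlus : LieSubalgebra ℂ G := LieSubalgebra.lieSpan ℂ G {e, ebar}

/-- The Borel subalgebra, the sum of `cartan` and `nPlus`. -/
def borel : LieSubalgebra ℂ G := cartan ⊔ nPlus

def hC : cartan := ⟨h, LieSubalgebra.subset_lieSpan (by simp)⟩

def hbarC : cartan := ⟨hbar, LieSubalgebra.subset_lieSpan (by simp)⟩

/-- Weights: linear functionals on the Cartan subalgebra. -/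
abbrev Weight : Type := Module.Dual ℂ cartan

/-- The functional on `sl₂` with `A ↦ A₀₀ - A₁₁`. -/
def slAlpha : SL2 →ₗ[ℂ] ℂ where
  toFun A := A.1 0 0 - A.1 1 1
  map_add' A B := by simp; ring
  map_smul' c A := by simp; ring

/-- The weight `α`, with `α(h) = 2` and `α(hbar) = 0`. -/
def alpha : Weight :=
  (TensorProduct.lift ((LinearMap.mul ℂ ℂ).compl₁₂
    (TrivSqZeroExt.fstHom ℂ ℂ ℂ).toLinearMap slAlpha)) ∘ₗ cartan.toSubmodule.subtype

theorem alpha_hC : alpha hC = 2 := by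
  change (1 : ℂ) * (1 - -1) = 2
  norm_num

theorem alpha_hbarC : alpha hbarC = 0 := by
  change (0 : ℂ) * (1 - -1) = 0
  norm_num

/-- The weights `lam` with `lam(hbar) = 0`. -/
def weightsZero : Submodule ℂ Weight where
  carrier := {lam | lam hbarC = 0}
  add_mem' ha hb := by simp_all
  zero_mem' := by simp
  smul_mem' c a ha := by simp_all

/-- The root `α` as a weight vanishing on `hbar`. -/
def alphaZero : weightsZero := ⟨alpha, alpha_hbarC⟩

/-- The set of cosets of `ℤα` in the group of weights vanishing on `hbar`. -/
abbrev Coset : Type := weightsZero ⧸ AddSubgroup.zmultiples alphaZero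

/-- The universal enveloping algebra `U(𝔤)`. -/
abbrev U : Type := UniversalEnvelopingAlgebra ℂ G

/-- The inclusion of `𝔤` into `U(𝔤)`. -/
abbrev inU (x : G) : U := UniversalEnvelopingAlgebra.ι ℂ x

open scoped ModuleCat

/-- The `ℂ`-linear action of `x ∈ 𝔤` on a `𝔤`-module. -/
def act (M : ModuleCat.{0} U) (x : G) : Module.End ℂ M := Algebra.lsmul ℂ ℂ M (inU x)

/-- The action of `U(𝔞)` on `M` is locally finite: `U(𝔞) v` is finite dimensional for all `v`.
Here `U(𝔞)` acts through its image in `U(𝔤)`, the subalgebra generated by `𝔞`. -/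
def IsLocallyFinite (a : LieSubalgebra ℂ G) (M : ModuleCat.{0} U) : Prop :=
  ∀ v : M, FiniteDimensional ℂ
    (Submodule.map ((LinearMap.toSpanSingleton U M v).restrictScalars ℂ)
      (Subalgebra.toSubmodule (Algebra.adjoin ℂ (inU '' (a : Set G)))))

/-- The generalized weight space `M^lam`: the vectors killed by some power of `x - lam(x)`,
for every `x` in the Cartan subalgebra. -/
def genWeightSpace (M : ModuleCat.{0} U) (lam : Weight) : Submodule ℂ M :=
  ⨅ x : cartan, (act M x).maxGenEigenspace (lam x)

/-- The support of a module. -/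
def supp (M : ModuleCat.{0} U) : Set Weight := {lam | genWeightSpace M lam ≠ ⊥}

/-- Weight modules: the Cartan subalgebra acts locally finitely and `h` acts diagonalizably. -/
def IsWeightModule (M : ModuleCat.{0} U) : Prop :=
  IsLocallyFinite cartan M ∧ ⨆ c : ℂ, (act M h).eigenspace c = ⊤

/-- Thick category `𝒪`: finitely generated modules on which `U(borel)` acts locally finitely. -/
def thickO : ObjectProperty (ModuleCat.{0} U) :=
  fun M => Module.Finite U M ∧ IsLocallyFinite borel M

/-- Classical category `𝒪`: the weight modules in thick category `𝒪`. -/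
def classicalO : ObjectProperty (ModuleCat.{0} U) :=
  fun M => thickO M ∧ IsWeightModule M

/-- The left ideal of `U(𝔤)` generated by `nPlus` and all `x - lam(x)`, `x ∈ cartan`. -/
def vermaIdeal (lam : Weight) : Submodule U U :=
  Submodule.span U
    (inU '' (nPlus : Set G) ∪ Set.range fun x : cartan => inU x - algebraMap ℂ U (lam x))

/-- The Verma module `Δ(lam)`, induced from the one-dimensional module of `borel` on which
`nPlus` acts by zero and the Cartan subalgebra acts by `lam`. -/
abbrev Verma (lam : Weight) : Type := U ⧸ vermaIdeal lam

/-- The simple quotient `L(lam)` of `Δ(lam)`: the quotient by the sum of all proper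
submodules. -/
def L (lam : Weight) : ModuleCat.{0} U :=
  ModuleCat.of U (Verma lam ⧸ sSup {N : Submodule U (Verma lam) | N ≠ ⊤})

/-- `X(lam)`, for `lam(hbar) ≠ 0`: the modules in `X` all of whose simple subquotients
`N' / (N ∩ N')` are isomorphic to `L(lam)`. -/
def easyBlock (X : ObjectProperty (ModuleCat.{0} U)) (lam : Weight) :
    ObjectProperty (ModuleCat.{0} U) :=
  fun M => X M ∧ ∀ N N' : Submodule U M, IsSimpleModule U (N' ⧸ N.submoduleOf N') →
    Nonempty ((N' ⧸ N.submoduleOf N') ≃ₗ[U] L lam)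

/-- `X(ξ)`, for a coset `ξ`: the modules in `X` whose support is contained in `ξ`. -/
def cosetBlock (X : ObjectProperty (ModuleCat.{0} U)) (xi : Coset) :
    ObjectProperty (ModuleCat.{0} U) :=
  fun M => X M ∧ ∀ lam ∈ supp M, ∃ mu : weightsZero,
    (mu : Weight) = lam ∧ (QuotientAddGroup.mk mu : Coset) = xi

/-- The index set of the blocks: weights not vanishing on `hbar`, and cosets of `ℤα` in the
group of weights vanishing on `hbar`. -/
abbrev BlockIndex : Type := {lam : Weight // lam hbarC ≠ 0} ⊕ Coset

/-- The family of all blocks of `X`. -/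
def block (X : ObjectProperty (ModuleCat.{0} U)) :
    BlockIndex → ObjectProperty (ModuleCat.{0} U) :=
  Sum.elim (fun lam => easyBlock X lam.1) (cosetBlock X)

end

end Takiff

/-! The element `casimir`, that is `h·hbar + 2hbar + 2f·ebar + 2fbar·e`, is central in `U(𝔤)`. On a
module of thick category `𝒪` the commuting operators `h`, `hbar` and `casimir` are locally finite,
so the module is the direct sum of the joint generalized eigenspaces `primary M (a, c, d)`. The
action of `𝔤` preserves `c` (because `ad hbar` squares to zero) and `d`, and moves `a` by even
integers.

A singular vector of weight `(a, c)` has Casimir eigenvalue `d = c(a + 2)`. If `c ≠ 0`, this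
determines `a = d/c - 2`, so fixing `(c, d)` leaves one possible highest weight; if `c = 0`, only
the class of `a` modulo `2ℤ` is retained. This is `blockIndex`, and `block_iff` identifies the
summands of the theorem with the modules of a single index. The bridge is `exists_isSingular`:
weight vectors can be raised to singular vectors. For `c ≠ 0` a nonzero submodule of a Verma module
contains a singular vector, necessarily of the highest weight, so the Verma module is simple. Its
support comes from `e fbar^(n+1) v = (n+1) c fbar^n v`.

For indecomposability, suppose a block splits into two summands. A Verma module is indecomposable,
its highest weight space being a line, so it lies in one summand. Every nonzero object receives a
nonzero map from a Verma module, which must then lie in the same summand. For `c ≠ 0` the block has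
one Verma module; for `c = 0` the vectors `fbar^n v` are singular, and any two Verma modules of the
block are linked by a nonzero map. So one summand is zero. That `fbar^n v ≠ 0` in a Verma module is
seen in an explicit action on power series, which takes the place of a PBW basis. -/

namespace Takiff

noncomputable section

open scoped ModuleCat

/-! ### Brackets of the six standard elements -/

section Relations

theorem lie_slE_slF : ⁅slE, slF⁆ = slH := by
  ext i j
  fin_cases i <;> fin_cases j <;> simp [slE, slF, slH, Ring.lie_def]

theorem lie_slH_slE : ⁅slH, slE⁆ = (2 : ℂ) • slE := by
  ext i j
  fin_cases i <;> fin_cases j <;> norm_num [slE, slH, Ring.lie_def]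

theorem lie_slH_slF : ⁅slH, slF⁆ = (-2 : ℂ) • slF := by
  ext i j
  fin_cases i <;> fin_cases j <;> norm_num [slF, slH, Ring.lie_def]

theorem sl_apply_one_one (A : SL2) : A.1 1 1 = -A.1 0 0 := by
  have h0 : A.1.trace = 0 := A.2
  rw [Matrix.trace_fin_two] at h0
  linear_combination h0

theorem sl_eq (A : SL2) : A = A.1 0 0 • slH + A.1 0 1 • slE + A.1 1 0 • slF := by
  ext i j
  fin_cases i <;> fin_cases j <;> simp [slE, slF, slH, sl_apply_one_one A]

theorem dualNumber_eq (p : DualNumber ℂ) :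
    p = p.fst • (1 : DualNumber ℂ) + p.snd • DualNumber.eps := by
  ext <;> simp

/-- `𝔤` is spanned by the six standard elements. -/
theorem span_basis_eq_top : Submodule.span ℂ {e, f, h, ebar, fbar, hbar} = ⊤ := by
  set S := Submodule.span ℂ {e, f, h, ebar, fbar, hbar} with hS
  have h1 : e ∈ S := Submodule.subset_span (by simp)
  have h2 : f ∈ S := Submodule.subset_span (by simp)
  have h3 : h ∈ S := Submodule.subset_span (by simp)
  have h4 : ebar ∈ S := Submodule.subset_span (by simp)
  have h5 : fbar ∈ S := Submodule.subset_span (by simp)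
  have h6 : hbar ∈ S := Submodule.subset_span (by simp)
  rw [eq_top_iff]
  intro x _
  induction x using TensorProduct.induction_on with
  | zero => exact S.zero_mem
  | add x y hx hy => exact S.add_mem (hx trivial) (hy trivial)
  | tmul p A =>
    rw [sl_eq A, dualNumber_eq p]
    simp only [TensorProduct.add_tmul, TensorProduct.tmul_add, ← TensorProduct.smul_tmul',
      TensorProduct.tmul_smul]
    have key : ∀ (a b c : ℂ) {x y : G}, x ∈ S → y ∈ S → a • (b • x + c • y) ∈ S :=
      fun a b c x y hx hy => S.smul_mem _ (S.add_mem (S.smul_mem _ hx) (S.smul_mem _ hy))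
    exact S.add_mem (S.add_mem (key _ _ _ h3 h6) (key _ _ _ h1 h4)) (key _ _ _ h2 h5)

theorem lie_e_f : ⁅e, f⁆ = h := by simp [e, f, h, lie_slE_slF]

theorem lie_e_fbar : ⁅e, fbar⁆ = hbar := by simp [e, fbar, hbar, lie_slE_slF]

theorem lie_ebar_f : ⁅ebar, f⁆ = hbar := by simp [ebar, f, hbar, lie_slE_slF]

theorem lie_ebar_fbar : ⁅ebar, fbar⁆ = 0 := by simp [ebar, fbar]

theorem lie_h_e : ⁅h, e⁆ = (2 : ℂ) • e := by
  simp only [h, e, LieAlgebra.ExtendScalars.bracket_tmul, lie_slH_slE, TensorProduct.tmul_smul,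
    mul_one]

theorem lie_h_f : ⁅h, f⁆ = (-2 : ℂ) • f := by
  simp only [h, f, LieAlgebra.ExtendScalars.bracket_tmul, lie_slH_slF, TensorProduct.tmul_smul,
    mul_one]

theorem lie_h_ebar : ⁅h, ebar⁆ = (2 : ℂ) • ebar := by
  simp only [h, ebar, LieAlgebra.ExtendScalars.bracket_tmul, lie_slH_slE, TensorProduct.tmul_smul,
    one_mul]

theorem lie_h_fbar : ⁅h, fbar⁆ = (-2 : ℂ) • fbar := by
  simp only [h, fbar, LieAlgebra.ExtendScalars.bracket_tmul, lie_slH_slF, TensorProduct.tmul_smul,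
    one_mul]

theorem lie_hbar_e : ⁅hbar, e⁆ = (2 : ℂ) • ebar := by
  simp only [hbar, e, ebar, LieAlgebra.ExtendScalars.bracket_tmul, lie_slH_slE,
    TensorProduct.tmul_smul, mul_one]

theorem lie_hbar_f : ⁅hbar, f⁆ = (-2 : ℂ) • fbar := by
  simp only [hbar, f, fbar, LieAlgebra.ExtendScalars.bracket_tmul, lie_slH_slF,
    TensorProduct.tmul_smul, mul_one]

theorem lie_hbar_ebar : ⁅hbar, ebar⁆ = 0 := by simp [hbar, ebar]

theorem lie_hbar_fbar : ⁅hbar, fbar⁆ = 0 := by simp [hbar, fbar]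

theorem lie_h_hbar : ⁅h, hbar⁆ = 0 := by simp [h, hbar]

theorem lie_e_ebar : ⁅e, ebar⁆ = 0 := by simp [e, ebar]

theorem lie_f_fbar : ⁅f, fbar⁆ = 0 := by simp [f, fbar]

attribute [local instance] LieRing.ofAssociativeRing LieAlgebra.ofAssociativeAlgebra

theorem inU_lie (x y : G) : inU ⁅x, y⁆ = inU x * inU y - inU y * inU x := by
  rw [inU, LieHom.map_lie, Ring.lie_def]

theorem inU_comm {x y z : G} (hxy : ⁅x, y⁆ = z) : inU x * inU y = inU y * inU x + inU z := by
  rw [← hxy, inU_lie]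
  abel

theorem inU_comm_zero {x y : G} (hxy : ⁅x, y⁆ = 0) : inU x * inU y = inU y * inU x := by
  rw [inU_comm hxy]
  simp

theorem inU_comm_smul {x y z : G} {c : ℂ} (hxy : ⁅x, y⁆ = c • z) :
    inU x * inU y = inU y * inU x + c • inU z := by
  rw [inU_comm hxy]
  simp

end Relations

/-! ### A central element of `U(𝔤)` -/

section Casimir

/-- The Casimir element of `U(𝔤)` that is linear in the barred variables. -/
def casimir : U :=
  inU h * inU hbar + 2 * inU hbar + 2 * (inU f * inU ebar) + 2 * (inU fbar * inU e)

/-- The coefficients come from moving the generator through each term of `casimir`: every factor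
crossed contributes one bracket relation, multiplied by the factors to its left and right. The
scalars are first written as sums, so that the final identity is one of noncommutative rings. -/
theorem casimir_comm_e : casimir * inU e = inU e * casimir := by
  have r1 := inU_comm_smul lie_hbar_e
  have r2 := inU_comm_smul lie_h_e
  have r3 := inU_comm_zero lie_e_ebar
  have r4 := inU_comm lie_e_f
  have r5 := inU_comm lie_e_fbar
  rw [two_smul] at r1 r2
  unfold casimir
  linear_combination (norm := noncomm_ring) inU h * r1 + r2 * inU hbar - 2 * (inU f * r3)
    - 2 * (r4 * inU ebar) - 2 * (r5 * inU e)

theorem casimir_comm_f : casimir * inU f = inU f * casimir := by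
  have r1 := inU_comm_smul lie_hbar_f
  have r2 := inU_comm_smul lie_h_f
  have r3 := inU_comm lie_ebar_f
  have r4 := inU_comm lie_e_f
  have r5 := inU_comm_zero lie_f_fbar
  have r6 := inU_comm_smul lie_h_fbar
  rw [neg_smul, two_smul] at r1 r2 r6
  unfold casimir
  linear_combination (norm := noncomm_ring) inU h * r1 + r2 * inU hbar + 2 * r1
    + 2 * (inU f * r3) + 2 * (inU fbar * r4) - 2 * (r5 * inU e) - 2 * r6

theorem casimir_comm_ebar : casimir * inU ebar = inU ebar * casimir := by
  have r1 := inU_comm_zero lie_hbar_ebar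
  have r2 := inU_comm_smul lie_h_ebar
  have r3 := inU_comm lie_ebar_f
  have r4 := inU_comm_zero lie_e_ebar
  have r5 := inU_comm_zero lie_ebar_fbar
  rw [two_smul] at r2
  unfold casimir
  linear_combination (norm := noncomm_ring) inU h * r1 + r2 * inU hbar
    - 2 * (r3 * inU ebar) + 2 * (inU fbar * r4) - 2 * (r5 * inU e)

theorem casimir_comm_fbar : casimir * inU fbar = inU fbar * casimir := by
  have r1 := inU_comm_zero lie_hbar_fbar
  have r2 := inU_comm_smul lie_h_fbar
  have r3 := inU_comm_zero lie_ebar_fbar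
  have r4 := inU_comm_zero lie_f_fbar
  have r5 := inU_comm lie_e_fbar
  rw [neg_smul, two_smul] at r2
  unfold casimir
  linear_combination (norm := noncomm_ring) inU h * r1 + r2 * inU hbar + 2 * r1
    + 2 * (inU f * r3) + 2 * (r4 * inU ebar) + 2 * (inU fbar * r5)

theorem casimir_comm_h : casimir * inU h = inU h * casimir := by
  have r0 := inU_comm_zero lie_h_hbar
  have r1 := inU_comm_smul lie_h_ebar
  have r2 := inU_comm_smul lie_h_f
  have r3 := inU_comm_smul lie_h_e
  have r4 := inU_comm_smul lie_h_fbar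
  rw [neg_smul, two_smul] at r2 r4
  rw [two_smul] at r1 r3
  unfold casimir
  linear_combination (norm := noncomm_ring) -(inU h * r0) - 2 * r0 - 2 * (inU f * r1)
    - 2 * (r2 * inU ebar) - 2 * (inU fbar * r3) - 2 * (r4 * inU e)

theorem casimir_comm_hbar : casimir * inU hbar = inU hbar * casimir := by
  have r0 := inU_comm_zero lie_h_hbar
  have r1 := inU_comm_zero lie_hbar_ebar
  have r2 := inU_comm_smul lie_hbar_f
  have r3 := inU_comm_smul lie_hbar_e
  have r4 := inU_comm_zero lie_hbar_fbar
  rw [neg_smul, two_smul] at r2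
  rw [two_smul] at r3
  unfold casimir
  linear_combination (norm := noncomm_ring) r0 * inU hbar - 2 * (inU f * r1)
    - 2 * (r2 * inU ebar) - 2 * (inU fbar * r3) - 2 * (r4 * inU e)

end Casimir

/-! ### Reducing statements about `U(𝔤)` to the six standard elements -/

section Generation

attribute [local instance] LieRing.ofAssociativeRing LieAlgebra.ofAssociativeAlgebra

/-- By the universal property `inU`, corestricted to `S`, extends to an algebra map from `U` to `S`.
Followed by the inclusion it fixes `𝔤`, hence is the identity. -/
theorem subalgebra_eq_top_of_inU_mem (S : Subalgebra ℂ U) (hS : ∀ x : G, inU x ∈ S) :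
    S = ⊤ := by
  let g : G →ₗ⁅ℂ⁆ S :=
    { toFun := fun x => ⟨inU x, hS x⟩
      map_add' := fun x y => by ext; simp
      map_smul' := fun c x => by ext; simp
      map_lie' := fun {x y} => by
        ext
        simp only [Ring.lie_def, Subalgebra.coe_sub, Subalgebra.coe_mul]
        exact inU_lie x y }
  have key : S.val.comp (UniversalEnvelopingAlgebra.lift ℂ g) = AlgHom.id ℂ U := by
    ext x
    simp [g]
  rw [eq_top_iff]
  intro u _
  have := DFunLike.congr_fun key u
  rw [AlgHom.id_apply] at this
  rw [← this]
  exact (UniversalEnvelopingAlgebra.lift ℂ g u).2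

/-- The standard elements of `𝔤`. -/
def stdBasis : Set G := {e, f, h, ebar, fbar, hbar}

theorem forall_stdBasis {P : G → Prop} (h1 : P e) (h2 : P f) (h3 : P h) (h4 : P ebar)
    (h5 : P fbar) (h6 : P hbar) : ∀ x ∈ stdBasis, P x := by
  rintro x (rfl | rfl | rfl | rfl | rfl | rfl) <;> assumption

theorem subalgebra_eq_top (S : Subalgebra ℂ U) (hS : ∀ x ∈ stdBasis, inU x ∈ S) : S = ⊤ := by
  refine subalgebra_eq_top_of_inU_mem S fun x => ?_
  have hx : x ∈ Submodule.span ℂ stdBasis := by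
    rw [stdBasis, span_basis_eq_top]
    trivial
  induction hx using Submodule.span_induction with
  | mem x hx => exact hS x hx
  | zero => simp
  | add x y _ _ hx hy => simpa using S.add_mem hx hy
  | smul c x _ hx => simpa using S.smul_mem hx c

theorem casimir_comm (u : U) : casimir * u = u * casimir := by
  have : Subalgebra.centralizer ℂ {casimir} = ⊤ := by
    apply subalgebra_eq_top
    apply forall_stdBasis <;> simp only [Subalgebra.mem_centralizer_iff, Set.mem_singleton_iff,
      forall_eq]
    exacts [casimir_comm_e, casimir_comm_f, casimir_comm_h, casimir_comm_ebar, casimir_comm_fbar,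
      casimir_comm_hbar]
  have hu : u ∈ Subalgebra.centralizer ℂ {casimir} := this ▸ trivial
  simpa [Subalgebra.mem_centralizer_iff] using hu

variable {M : ModuleCat.{0} U}

theorem act_apply (x : G) (v : M) : act M x v = inU x • v := rfl

/-- The `ℂ`-linear action of the Casimir element. -/
def actCasimir (M : ModuleCat.{0} U) : Module.End ℂ M := Algebra.lsmul ℂ ℂ M casimir

/-- The subalgebra of `U(𝔤)` stabilizing a subspace. -/
def stabilizer (p : Submodule ℂ M) : Subalgebra ℂ U where
  carrier := {u | ∀ v ∈ p, u • v ∈ p}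
  mul_mem' ha hb v hv := by
    rw [mul_smul]
    exact ha _ (hb _ hv)
  add_mem' ha hb v hv := by
    rw [add_smul]
    exact p.add_mem (ha _ hv) (hb _ hv)
  algebraMap_mem' c v hv := by
    rw [algebraMap_smul]
    exact p.smul_mem c hv

theorem stabilizer_eq_top (p : Submodule ℂ M) (hp : ∀ x ∈ stdBasis, ∀ v ∈ p, inU x • v ∈ p) :
    stabilizer p = ⊤ :=
  subalgebra_eq_top _ fun x hx v hv => hp x hx v hv

/-- A subspace stable under the standard elements of `𝔤`, as a submodule. -/
def toUSubmodule (p : Submodule ℂ M) (hp : ∀ x ∈ stdBasis, ∀ v ∈ p, inU x • v ∈ p) :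
    Submodule U M where
  toAddSubmonoid := p.toAddSubmonoid
  smul_mem' u v hv := by
    have hu : u ∈ stabilizer p := stabilizer_eq_top p hp ▸ trivial
    exact hu v hv

end Generation

/-! ### Weights as pairs of values on `h` and `hbar` -/

section Weights

theorem lie_combination_eq_zero {A : Type*} [LieRing A] [LieAlgebra ℂ A] {x y : A}
    (hxy : ⁅x, y⁆ = 0) (a b c d : ℂ) : ⁅a • x + b • y, c • x + d • y⁆ = 0 := by
  have hyx : ⁅y, x⁆ = 0 := by rw [← lie_skew, hxy, neg_zero]
  simp [hxy, hyx]

/-- Since `h` and `hbar` commute, the plane they span is already a Lie subalgebra. -/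
theorem mem_cartan {x : G} (hx : x ∈ cartan) : ∃ a b : ℂ, x = a • h + b • hbar := by
  let K : LieSubalgebra ℂ G :=
    { (Submodule.span ℂ {h, hbar} : Submodule ℂ G) with
      lie_mem' := by
        intro x y hx hy
        obtain ⟨a, b, rfl⟩ := Submodule.mem_span_pair.1 hx
        obtain ⟨c, d, rfl⟩ := Submodule.mem_span_pair.1 hy
        have := lie_combination_eq_zero (A := G) lie_h_hbar a b c d
        rw [this]
        exact Submodule.zero_mem _ }
  have hK : cartan ≤ K := by
    refine LieSubalgebra.lieSpan_le.2 ?_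
    rintro x (rfl | rfl)
    · exact Submodule.subset_span (by simp)
    · exact Submodule.subset_span (by simp)
  obtain ⟨a, b, hab⟩ := Submodule.mem_span_pair.1 (hK hx)
  exact ⟨a, b, hab.symm⟩

theorem cartan_eq (x : cartan) : ∃ a b : ℂ, x = a • hC + b • hbarC := by
  obtain ⟨a, b, hab⟩ := mem_cartan x.2
  exact ⟨a, b, Subtype.ext hab⟩

theorem weight_ext {lam mu : Weight} (h1 : lam hC = mu hC) (h2 : lam hbarC = mu hbarC) :
    lam = mu := by
  ext x
  obtain ⟨a, b, rfl⟩ := cartan_eq x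
  simp [h1, h2]

/-- The functional `A ↦ A₀₀` on `sl₂`. -/
def slCoeff : SL2 →ₗ[ℂ] ℂ where
  toFun A := A.1 0 0
  map_add' A B := by simp
  map_smul' c A := by simp

/-- The weight with values `a` on `h` and `c` on `hbar`. -/
def wt (a c : ℂ) : Weight :=
  TensorProduct.lift ((LinearMap.mul ℂ ℂ).compl₁₂
    (a • (TrivSqZeroExt.fstHom ℂ ℂ ℂ).toLinearMap + c • TrivSqZeroExt.sndHom ℂ ℂ) slCoeff) ∘ₗ
    cartan.toSubmodule.subtype

theorem wt_hC (a c : ℂ) : wt a c hC = a := by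
  change (a * 1 + c * 0) * 1 = a
  ring

theorem wt_hbarC (a c : ℂ) : wt a c hbarC = c := by
  change (a * 0 + c * 1) * 1 = c
  ring

end Weights

end

end Takiff

/-! ### Generalized eigenspaces and locally finite operators -/

section LinearAlgebra

open Module.End

variable {V : Type*} [AddCommGroup V] [Module ℂ V]

/-- Takes the last nonzero iterate; applied several times below to produce singular vectors. -/
theorem exists_pow_apply_ne_zero {T : Module.End ℂ V} {v : V} (hv : v ≠ 0) {k : ℕ}
    (hk : (T ^ k) v = 0) : ∃ m, (T ^ m) v ≠ 0 ∧ T ((T ^ m) v) = 0 := by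
  classical
  have hex : ∃ k, (T ^ k) v = 0 := ⟨k, hk⟩
  have h0 : Nat.find hex ≠ 0 := by
    intro h
    have := Nat.find_spec hex
    rw [h] at this
    exact hv (by simpa using this)
  obtain ⟨m, hm⟩ := Nat.exists_eq_succ_of_ne_zero h0
  refine ⟨m, Nat.find_min hex (by omega), ?_⟩
  have := Nat.find_spec hex
  rwa [hm, Nat.succ_eq_add_one, pow_succ', Module.End.mul_apply] at this

/-- The relation says that `D` intertwines `T - a` with `T - (a + k)`, hence also their powers. -/
theorem mapsTo_maxGenEigenspace_add {T D : Module.End ℂ V} {k : ℂ} (hTD : T * D = D * T + k • D)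
    {a : ℂ} {v : V} (hv : v ∈ T.maxGenEigenspace a) : D v ∈ T.maxGenEigenspace (a + k) := by
  rw [mem_maxGenEigenspace] at hv ⊢
  obtain ⟨n, hn⟩ := hv
  have h1 : SemiconjBy D (T - a • 1) (T - (a + k) • 1) := by
    simp only [SemiconjBy, mul_sub, sub_mul, hTD, add_smul, add_mul, smul_mul_assoc, mul_smul_comm,
      one_mul, mul_one]
    abel
  refine ⟨n, ?_⟩
  have h2 := LinearMap.congr_fun (h1.pow_right n).eq v
  rw [Module.End.mul_apply, Module.End.mul_apply, hn, map_zero] at h2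
  exact h2.symm

/-- With `S = T - a`, the commutator `D'` commutes with `S`, so `S^(n+1) D = D S^(n+1) + (n+1) D'
S^n`, and one extra power of `S` kills `D v`. -/
theorem mapsTo_maxGenEigenspace_of_commutator {T D D' : Module.End ℂ V} (h1 : T * D = D * T + D')
    (h2 : T * D' = D' * T) {a : ℂ} {v : V} (hv : v ∈ T.maxGenEigenspace a) :
    D v ∈ T.maxGenEigenspace a := by
  rw [mem_maxGenEigenspace] at hv ⊢
  obtain ⟨n, hn⟩ := hv
  set S := T - a • (1 : Module.End ℂ V) with hS
  have hD : S * D = D * S + D' := by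
    simp only [hS, mul_sub, sub_mul, h1, smul_mul_assoc, mul_smul_comm, one_mul, mul_one]
    abel
  have hD' : Commute S D' := by
    simp only [Commute, SemiconjBy, hS, mul_sub, sub_mul, h2, smul_mul_assoc, mul_smul_comm,
      one_mul, mul_one]
  have key : ∀ n : ℕ, S ^ (n + 1) * D = D * S ^ (n + 1) + (n + 1) • (D' * S ^ n) := by
    intro n
    induction n with
    | zero => simp [hD]
    | succ n ih =>
      rw [pow_succ' S (n + 1), mul_assoc, ih, mul_add, ← mul_assoc, hD, mul_smul_comm, ← mul_assoc,
        hD'.eq, mul_assoc D' S, ← pow_succ', add_mul, mul_assoc D, ← pow_succ', add_assoc,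
        ← succ_nsmul' (D' * S ^ (n + 1)) (n + 1)]
  refine ⟨n + 1, ?_⟩
  have h3 := LinearMap.congr_fun (key n) v
  simp only [Module.End.mul_apply, LinearMap.add_apply, LinearMap.smul_apply, hn, pow_succ' S n,
    map_zero, smul_zero, add_zero] at h3 ⊢
  exact h3

/-- The vectors contained in a finite dimensional subspace stable under `T`. -/
def finitePart (T : Module.End ℂ V) : Submodule ℂ V where
  carrier := {v | ∃ W : Submodule ℂ V, FiniteDimensional ℂ W ∧ v ∈ W ∧ ∀ w ∈ W, T w ∈ W}
  zero_mem' := ⟨⊥, inferInstance, by simp, by simp⟩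
  add_mem' := by
    rintro v v' ⟨W, hW, hv, hT⟩ ⟨W', hW', hv', hT'⟩
    refine ⟨W ⊔ W', inferInstance, Submodule.add_mem_sup hv hv', fun w hw => ?_⟩
    obtain ⟨y, hy, z, hz, rfl⟩ := Submodule.mem_sup.1 hw
    rw [map_add]
    exact Submodule.add_mem_sup (hT y hy) (hT' z hz)
  smul_mem' := by
    rintro c v ⟨W, hW, hv, hT⟩
    exact ⟨W, hW, W.smul_mem c hv, hT⟩

/-- A stable subspace containing `T v - c v` stays stable when `v` is adjoined. Consequently a
vector that is an eigenvector modulo `finitePart T` already belongs to it. -/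
theorem mem_finitePart_of_sub_mem {T : Module.End ℂ V} {c : ℂ} {v : V}
    (hv : T v - c • v ∈ finitePart T) : v ∈ finitePart T := by
  obtain ⟨W, hW, hvW, hT⟩ := hv
  refine ⟨W ⊔ ℂ ∙ v, inferInstance,
    Submodule.mem_sup_right (Submodule.mem_span_singleton_self v), fun w hw => ?_⟩
  obtain ⟨y, hy, z, hz, rfl⟩ := Submodule.mem_sup.1 hw
  obtain ⟨r, rfl⟩ := Submodule.mem_span_singleton.1 hz
  have : T (y + r • v) = (T y + r • (T v - c • v)) + (r * c) • v := by
    rw [map_add, map_smul, smul_sub, mul_smul]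
    abel
  rw [this]
  exact Submodule.add_mem_sup (W.add_mem (hT y hy) (W.smul_mem r hvW))
    (Submodule.smul_mem _ _ (Submodule.mem_span_singleton_self v))

/-- The operator restricts to the finite dimensional space `p ⊓ W`, which over `ℂ` is spanned by
generalized eigenvectors. -/
theorem mem_iSup_inf_maxGenEigenspace {T : Module.End ℂ V} {p : Submodule ℂ V}
    (hp : ∀ w ∈ p, T w ∈ p) {v : V} (hv : v ∈ p) (hv' : v ∈ finitePart T) :
    v ∈ ⨆ a : ℂ, p ⊓ T.maxGenEigenspace a := by
  obtain ⟨W, hW, hvW, hT⟩ := hv'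
  have hfd : FiniteDimensional ℂ ↥(p ⊓ W) :=
    Submodule.finiteDimensional_of_le (inf_le_right : p ⊓ W ≤ W)
  have hst : ∀ w ∈ p ⊓ W, T w ∈ p ⊓ W := fun w hw => ⟨hp w hw.1, hT w hw.2⟩
  have htop := iSup_maxGenEigenspace_eq_top (T.restrict hst)
  have h1 : (p ⊓ W) = ⨆ a : ℂ, (p ⊓ W) ⊓ T.maxGenEigenspace a := by
    have h2 : ∀ a : ℂ, (p ⊓ W) ⊓ T.maxGenEigenspace a =
        (maxGenEigenspace (T.restrict hst) a).map (p ⊓ W).subtype :=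
      fun a => Submodule.inf_genEigenspace T _ hst
    simp_rw [h2]
    rw [← Submodule.map_iSup, htop, Submodule.map_subtype_top]
  have h3 : v ∈ p ⊓ W := ⟨hv, hvW⟩
  rw [h1] at h3
  have h4 : ⨆ a : ℂ, (p ⊓ W) ⊓ T.maxGenEigenspace a ≤ ⨆ a : ℂ, p ⊓ T.maxGenEigenspace a :=
    iSup_mono fun a => inf_le_inf_right _ inf_le_left
  exact h4 h3

theorem finitePart_eq_iSup (T : Module.End ℂ V) :
    finitePart T = ⨆ a : ℂ, T.maxGenEigenspace a := by
  apply le_antisymm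
  · intro v hv
    simpa using mem_iSup_inf_maxGenEigenspace (p := ⊤) (by simp) trivial hv
  · refine iSup_le fun a v hv => ?_
    obtain ⟨k, hk⟩ := (mem_maxGenEigenspace _ _ _).1 hv
    have key : ∀ k : ℕ, ∀ v : V, ((T - a • (1 : Module.End ℂ V)) ^ k) v = 0 →
        v ∈ finitePart T := by
      intro k
      induction k with
      | zero =>
        intro v hv
        rw [pow_zero, Module.End.one_apply] at hv
        rw [hv]
        exact Submodule.zero_mem _
      | succ k ih =>
        intro v hv
        rw [pow_succ, Module.End.mul_apply] at hv
        exact mem_finitePart_of_sub_mem (c := a) (by simpa using ih _ hv)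
    exact key k v hk

/-- In a finite dimensional subspace, an operator shifting the generalized eigenvalues of another
operator is nilpotent. -/
theorem exists_pow_apply_eq_zero {T D : Module.End ℂ V} {k : ℂ} (hk : k ≠ 0)
    (hTD : T * D = D * T + k • D) {W : Submodule ℂ V} [FiniteDimensional ℂ W]
    (hD : ∀ w ∈ W, D w ∈ W) {a : ℂ} {v : V} (hvW : v ∈ W) (hv : v ∈ T.maxGenEigenspace a) :
    ∃ n : ℕ, (D ^ n) v = 0 := by
  -- Otherwise the iterates `D^n v` are nonzero vectors of `W` in generalized eigenspaces for the
  -- distinct values `a + n k`, hence infinitely many independent vectors.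
  by_contra! hne
  have h1 : ∀ n : ℕ, (D ^ n) v ∈ W := by
    intro n
    induction n with
    | zero => simpa using hvW
    | succ n ih =>
      rw [pow_succ', Module.End.mul_apply]
      exact hD _ ih
  have h2 : ∀ n : ℕ, (D ^ n) v ∈ T.maxGenEigenspace (a + n * k) := by
    intro n
    induction n with
    | zero => simpa using hv
    | succ n ih =>
      rw [pow_succ', Module.End.mul_apply]
      have := mapsTo_maxGenEigenspace_add hTD ih
      convert this using 2
      push_cast
      ring
  have hinj : Function.Injective fun n : ℕ => a + n * k := by
    intro m n hmn
    have : (m : ℂ) * k = n * k := by simpa using hmn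
    exact_mod_cast mul_right_cancel₀ hk this
  have hli : LinearIndependent ℂ fun n : ℕ => (D ^ n) v :=
    ((independent_maxGenEigenspace T).comp hinj).linearIndependent _ h2 hne
  have hli' : LinearIndependent ℂ fun n : ℕ => (⟨(D ^ n) v, h1 n⟩ : W) :=
    LinearIndependent.of_comp W.subtype hli
  exact not_finite_iff_infinite.2 (inferInstance : Infinite ℕ) hli'.finite

theorem iSupIndep_fiber {ι κ : Type*} {R N : Type*} [Ring R] [AddCommGroup N] [Module R N]
    {t : ι → Submodule R N} (ht : iSupIndep t) (b : ι → κ) :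
    iSupIndep fun k => ⨆ i ∈ {i | b i = k}, t i := by
  intro k
  have h1 : Disjoint {i | b i = k} {i | b i ≠ k} :=
    Set.disjoint_left.2 fun i hi hi' => hi' hi
  refine (ht.disjoint_biSup_biSup h1).mono_right ?_
  refine iSup₂_le fun l hl => iSup₂_le fun i hi => ?_
  exact le_iSup₂_of_le (f := fun i (_ : i ∈ {i | b i ≠ k}) => t i) i
    (fun h => hl ((Set.mem_ofPred.1 hi).symm.trans h)) le_rfl

end LinearAlgebra

namespace Takiff

noncomputable section

open scoped ModuleCat

/-! ### Local finiteness under the Borel subalgebra -/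

section LocalFiniteness

attribute [local instance] LieRing.ofAssociativeRing LieAlgebra.ofAssociativeAlgebra

/-- The Lie algebra elements whose image in `U(𝔤)` lies in a given subalgebra. -/
def lieComap (S : Subalgebra ℂ U) : LieSubalgebra ℂ G where
  carrier := {x | inU x ∈ S}
  zero_mem' := by simp
  add_mem' ha hb := by
    simpa using S.add_mem ha hb
  smul_mem' c x hx := by
    simpa using S.smul_mem hx c
  lie_mem' {x y} hx hy := by
    change inU ⁅x, y⁆ ∈ S
    rw [inU_lie]
    exact S.sub_mem (S.mul_mem hx hy) (S.mul_mem hy hx)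

variable {M N : ModuleCat.{0} U}

/-- The subspace `p` is stable under the standard elements of the Borel subalgebra. -/
def IsBorelStable (p : Submodule ℂ M) : Prop :=
  ∀ v ∈ p, inU e • v ∈ p ∧ inU ebar • v ∈ p ∧ inU h • v ∈ p ∧ inU hbar • v ∈ p

theorem e_mem_borel : e ∈ borel :=
  (le_sup_right : nPlus ≤ borel) (LieSubalgebra.subset_lieSpan (by simp))

theorem ebar_mem_borel : ebar ∈ borel :=
  (le_sup_right : nPlus ≤ borel) (LieSubalgebra.subset_lieSpan (by simp))

theorem h_mem_borel : h ∈ borel :=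
  (le_sup_left : cartan ≤ borel) (LieSubalgebra.subset_lieSpan (by simp))

theorem hbar_mem_borel : hbar ∈ borel :=
  (le_sup_left : cartan ≤ borel) (LieSubalgebra.subset_lieSpan (by simp))

theorem IsBorelStable.borel_le {p : Submodule ℂ M} (hp : IsBorelStable p) :
    borel ≤ lieComap (stabilizer p) := by
  refine sup_le (LieSubalgebra.lieSpan_le.2 ?_) (LieSubalgebra.lieSpan_le.2 ?_)
  · rintro x (rfl | rfl)
    · exact fun v hv => (hp v hv).2.2.1
    · exact fun v hv => (hp v hv).2.2.2
  · rintro x (rfl | rfl)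
    · exact fun v hv => (hp v hv).1
    · exact fun v hv => (hp v hv).2.1

theorem IsBorelStable.sup {W W' : Submodule ℂ M} (hW : IsBorelStable W) (hW' : IsBorelStable W') :
    IsBorelStable (W ⊔ W') := by
  intro w hw
  obtain ⟨y, hy, z, hz, rfl⟩ := Submodule.mem_sup.1 hw
  obtain ⟨h1, h2, h3, h4⟩ := hW y hy
  obtain ⟨k1, k2, k3, k4⟩ := hW' z hz
  simp only [smul_add]
  exact ⟨Submodule.add_mem_sup h1 k1, Submodule.add_mem_sup h2 k2, Submodule.add_mem_sup h3 k3,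
    Submodule.add_mem_sup h4 k4⟩

/-- The vectors contained in a finite dimensional subspace stable under the Borel subalgebra. -/
def borelFinite (M : ModuleCat.{0} U) : Submodule ℂ M where
  carrier := {v | ∃ W : Submodule ℂ M, FiniteDimensional ℂ W ∧ v ∈ W ∧ IsBorelStable W}
  zero_mem' := ⟨⊥, inferInstance, by simp, by simp [IsBorelStable]⟩
  add_mem' := by
    rintro v v' ⟨W, hW, hv, hT⟩ ⟨W', hW', hv', hT'⟩
    exact ⟨W ⊔ W', inferInstance, Submodule.add_mem_sup hv hv', hT.sup hT'⟩
  smul_mem' := by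
    rintro c v ⟨W, hW, hv, hT⟩
    exact ⟨W, hW, W.smul_mem c hv, hT⟩

/-- With the converse below, this trades `U(𝔞) v` for a finite dimensional subspace stable under
four elements, which is easier to transport. -/
theorem isLocallyFinite_of_borelFinite_eq_top {a : LieSubalgebra ℂ G} (ha : a ≤ borel)
    (hM : borelFinite M = ⊤) : IsLocallyFinite a M := by
  intro v
  have hv : v ∈ borelFinite M := hM ▸ trivial
  obtain ⟨W, hW, hvW, hst⟩ := hv
  refine Submodule.finiteDimensional_of_le (S₂ := W) ?_
  rintro _ ⟨u, hu, rfl⟩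
  have h1 : Algebra.adjoin ℂ (inU '' (a : Set G)) ≤ stabilizer W := by
    refine Algebra.adjoin_le ?_
    rintro _ ⟨x, hx, rfl⟩
    exact hst.borel_le (ha hx)
  exact h1 hu v hvW

theorem IsLocallyFinite.borelFinite_eq_top (hM : IsLocallyFinite borel M) :
    borelFinite M = ⊤ := by
  rw [eq_top_iff]
  intro v _
  refine ⟨_, hM v, ⟨1, Subalgebra.one_mem _, by simp⟩, ?_⟩
  rintro _ ⟨u, hu, rfl⟩
  have key : ∀ x ∈ borel, inU x • (LinearMap.toSpanSingleton U M v).restrictScalars ℂ u ∈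
      Submodule.map ((LinearMap.toSpanSingleton U M v).restrictScalars ℂ)
        (Subalgebra.toSubmodule (Algebra.adjoin ℂ (inU '' (borel : Set G)))) := by
    intro x hx
    refine ⟨inU x * u, ?_, ?_⟩
    · exact Subalgebra.mul_mem _ (Algebra.subset_adjoin ⟨x, hx, rfl⟩) hu
    · simp [mul_smul]
  exact ⟨key _ e_mem_borel, key _ ebar_mem_borel, key _ h_mem_borel, key _ hbar_mem_borel⟩

theorem smul_comm_of {x y z : G} (hxy : inU x * inU y = inU y * inU x + inU z) (v : M) :
    inU x • inU y • v = inU y • inU x • v + inU z • v := by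
  rw [← mul_smul, hxy, add_smul, mul_smul]

theorem smul_comm_smul {x y z : G} {c : ℂ}
    (hxy : inU x * inU y = inU y * inU x + c • inU z) (v : M) :
    inU x • inU y • v = inU y • inU x • v + c • inU z • v := by
  rw [← mul_smul, hxy, add_smul, mul_smul, smul_assoc]

theorem smul_comm_zero {x y : G} (hxy : inU x * inU y = inU y * inU x) (v : M) :
    inU x • inU y • v = inU y • inU x • v := by
  rw [← mul_smul, hxy, mul_smul]

/-- Enlarging a subspace by the images of the lowering operators. -/
def lower (W : Submodule ℂ M) : Submodule ℂ M := W ⊔ W.map (act M f) ⊔ W.map (act M fbar)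

theorem le_lower (W : Submodule ℂ M) : W ≤ lower W := le_sup_left.trans le_sup_left

theorem f_smul_mem_lower {W : Submodule ℂ M} {w : M} (hw : w ∈ W) : inU f • w ∈ lower W :=
  Submodule.mem_sup_left (Submodule.mem_sup_right ⟨w, hw, rfl⟩)

theorem fbar_smul_mem_lower {W : Submodule ℂ M} {w : M} (hw : w ∈ W) : inU fbar • w ∈ lower W :=
  Submodule.mem_sup_right ⟨w, hw, rfl⟩

/-- The bracket of a Borel generator with `f` or `fbar` is zero or a multiple of `h`, `hbar`, `f` or
`fbar`, so moving it to the right never leaves `W + f W + fbar W`. This is what makes `borelFinite`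
stable under all of `𝔤`. -/
theorem IsBorelStable.lower {W : Submodule ℂ M} (hW : IsBorelStable W) :
    IsBorelStable (lower W) := by
  have key : ∀ x : G, (∀ w ∈ W, inU x • w ∈ Takiff.lower W) →
      (∀ w ∈ W, inU x • inU f • w ∈ Takiff.lower W) →
      (∀ w ∈ W, inU x • inU fbar • w ∈ Takiff.lower W) →
      ∀ v ∈ Takiff.lower W, inU x • v ∈ Takiff.lower W := by
    intro x h1 h2 h3 v hv
    obtain ⟨y, hy, z, ⟨w, hw, rfl⟩, rfl⟩ := Submodule.mem_sup.1 hv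
    obtain ⟨y', hy', z', ⟨w', hw', rfl⟩, rfl⟩ := Submodule.mem_sup.1 hy
    rw [smul_add, smul_add]
    exact Submodule.add_mem _ (Submodule.add_mem _ (h1 y' hy') (h2 w' hw')) (h3 w hw)
  have hle := le_lower W
  intro v hv
  refine ⟨key e ?_ ?_ ?_ v hv, key ebar ?_ ?_ ?_ v hv, key h ?_ ?_ ?_ v hv,
    key hbar ?_ ?_ ?_ v hv⟩ <;> intro w hw <;> obtain ⟨w1, w2, w3, w4⟩ := hW w hw
  · exact hle w1
  · rw [smul_comm_of (inU_comm lie_e_f)]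
    exact Submodule.add_mem _ (f_smul_mem_lower w1) (hle w3)
  · rw [smul_comm_of (inU_comm lie_e_fbar)]
    exact Submodule.add_mem _ (fbar_smul_mem_lower w1) (hle w4)
  · exact hle w2
  · rw [smul_comm_of (inU_comm lie_ebar_f)]
    exact Submodule.add_mem _ (f_smul_mem_lower w2) (hle w4)
  · rw [smul_comm_zero (inU_comm_zero lie_ebar_fbar)]
    exact fbar_smul_mem_lower w2
  · exact hle w3
  · rw [smul_comm_smul (inU_comm_smul lie_h_f)]
    exact Submodule.add_mem _ (f_smul_mem_lower w3) (Submodule.smul_mem _ _ (f_smul_mem_lower hw))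
  · rw [smul_comm_smul (inU_comm_smul lie_h_fbar)]
    exact Submodule.add_mem _ (fbar_smul_mem_lower w3)
      (Submodule.smul_mem _ _ (fbar_smul_mem_lower hw))
  · exact hle w4
  · rw [smul_comm_smul (inU_comm_smul lie_hbar_f)]
    exact Submodule.add_mem _ (f_smul_mem_lower w4)
      (Submodule.smul_mem _ _ (fbar_smul_mem_lower hw))
  · rw [smul_comm_zero (inU_comm_zero lie_hbar_fbar)]
    exact fbar_smul_mem_lower w4

instance finiteDimensional_lower {W : Submodule ℂ M} [FiniteDimensional ℂ W] :
    FiniteDimensional ℂ (lower W) := by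
  unfold lower
  infer_instance

theorem borelFinite_stable (M : ModuleCat.{0} U) :
    ∀ x ∈ stdBasis, ∀ v ∈ borelFinite M, inU x • v ∈ borelFinite M := by
  apply forall_stdBasis <;> rintro v ⟨W, hW, hvW, hst⟩
  · exact ⟨W, hW, (hst v hvW).1, hst⟩
  · exact ⟨lower W, inferInstance, f_smul_mem_lower hvW, hst.lower⟩
  · exact ⟨W, hW, (hst v hvW).2.2.1, hst⟩
  · exact ⟨W, hW, (hst v hvW).2.1, hst⟩
  · exact ⟨lower W, inferInstance, fbar_smul_mem_lower hvW, hst.lower⟩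
  · exact ⟨W, hW, (hst v hvW).2.2.2, hst⟩

theorem IsBorelStable.map {W : Submodule ℂ M} (hW : IsBorelStable W) (φ : M →ₗ[U] N) :
    IsBorelStable (W.map (φ.restrictScalars ℂ)) := by
  rintro _ ⟨w, hw, rfl⟩
  obtain ⟨h1, h2, h3, h4⟩ := hW w hw
  exact ⟨⟨_, h1, by simp⟩, ⟨_, h2, by simp⟩, ⟨_, h3, by simp⟩, ⟨_, h4, by simp⟩⟩

theorem map_mem_borelFinite (φ : M →ₗ[U] N) {v : M} (hv : v ∈ borelFinite M) :
    φ v ∈ borelFinite N := by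
  obtain ⟨W, hW, hvW, hst⟩ := hv
  exact ⟨W.map (φ.restrictScalars ℂ), inferInstance, ⟨v, hvW, rfl⟩, hst.map φ⟩

theorem mem_borelFinite_of_map_mem {φ : M →ₗ[U] N} (hφ : Function.Injective φ) {v : M}
    (hv : φ v ∈ borelFinite N) : v ∈ borelFinite M := by
  obtain ⟨W, hW, hvW, hst⟩ := hv
  refine ⟨W.comap (φ.restrictScalars ℂ), ?_, hvW, ?_⟩
  · exact FiniteDimensional.of_injective
      ((φ.restrictScalars ℂ).restrict (p := W.comap (φ.restrictScalars ℂ)) (q := W) fun x hx => hx)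
      fun x y hxy => Subtype.ext (hφ (congrArg Subtype.val hxy))
  · intro w hw
    obtain ⟨h1, h2, h3, h4⟩ := hst _ hw
    refine ⟨?_, ?_, ?_, ?_⟩ <;> simpa

theorem borelFinite_eq_top_of_injective {φ : M →ₗ[U] N} (hφ : Function.Injective φ)
    (hN : borelFinite N = ⊤) : borelFinite M = ⊤ :=
  eq_top_iff.2 fun _ _ => mem_borelFinite_of_map_mem hφ (hN ▸ trivial)

theorem borelFinite_eq_top_of_surjective {φ : M →ₗ[U] N} (hφ : Function.Surjective φ)
    (hM : borelFinite M = ⊤) : borelFinite N = ⊤ := by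
  refine eq_top_iff.2 fun x _ => ?_
  obtain ⟨v, rfl⟩ := hφ x
  exact map_mem_borelFinite φ (hM ▸ trivial)

end LocalFiniteness

end

end Takiff

/-! ### Intertwining maps and generalized eigenspaces -/

section LinearAlgebra

open Module.End

variable {V V' : Type*} [AddCommGroup V] [Module ℂ V] [AddCommGroup V'] [Module ℂ V']

theorem pow_apply_induction {T : Module.End ℂ V} {P : V → Prop} (hP : ∀ v, P v → P (T v)) {v : V}
    (hv : P v) (n : ℕ) : P ((T ^ n) v) := by
  induction n with
  | zero => simpa using hv
  | succ n ih =>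
    rw [pow_succ', Module.End.mul_apply]
    exact hP _ ih

theorem map_sub_pow_apply {T : Module.End ℂ V} {T' : Module.End ℂ V'} {φ : V →ₗ[ℂ] V'}
    (hφ : ∀ v, φ (T v) = T' (φ v)) (a : ℂ) (k : ℕ) (v : V) :
    ((T' - a • (1 : Module.End ℂ V')) ^ k) (φ v) =
      φ (((T - a • (1 : Module.End ℂ V)) ^ k) v) := by
  induction k generalizing v with
  | zero => simp
  | succ k ih =>
    rw [pow_succ, pow_succ, Module.End.mul_apply, Module.End.mul_apply, ← ih]
    simp [hφ]

theorem map_mem_maxGenEigenspace {T : Module.End ℂ V} {T' : Module.End ℂ V'} {φ : V →ₗ[ℂ] V'}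
    (hφ : ∀ v, φ (T v) = T' (φ v)) {a : ℂ} {v : V} (hv : v ∈ T.maxGenEigenspace a) :
    φ v ∈ T'.maxGenEigenspace a := by
  rw [mem_maxGenEigenspace] at hv ⊢
  obtain ⟨k, hk⟩ := hv
  exact ⟨k, by rw [map_sub_pow_apply hφ, hk, map_zero]⟩

end LinearAlgebra

namespace Takiff

noncomputable section

open scoped ModuleCat

open Module.End

variable {M N : ModuleCat.{0} U}

/-! ### Generalized weight spaces and the action of `𝔤` on them -/

section WeightSpaces

theorem act_comm_smul {x y z : G} {c : ℂ} (hxy : inU x * inU y = inU y * inU x + c • inU z) :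
    act M x * act M y = act M y * act M x + c • act M z :=
  LinearMap.ext fun v => smul_comm_smul hxy v

theorem act_comm_zero {x y : G} (hxy : inU x * inU y = inU y * inU x) :
    act M x * act M y = act M y * act M x :=
  LinearMap.ext fun v => smul_comm_zero hxy v

theorem act_h_comm_hbar : Commute (act M h) (act M hbar) :=
  act_comm_zero (inU_comm_zero lie_h_hbar)

theorem actCasimir_comm (x : G) : Commute (actCasimir M) (act M x) := by
  ext v
  change casimir • inU x • v = inU x • casimir • v
  rw [← mul_smul, casimir_comm, mul_smul]

/-- The simultaneous generalized eigenspace of `h` and `hbar`. -/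
def wtSpace (M : ModuleCat.{0} U) (a c : ℂ) : Submodule ℂ M :=
  (act M h).maxGenEigenspace a ⊓ (act M hbar).maxGenEigenspace c

theorem act_cartan (x y : ℂ) : act M (x • h + y • hbar) = x • act M h + y • act M hbar := by
  unfold act
  simp

/-- For commuting operators generalized eigenvalues add, so the conditions at `h` and `hbar` imply
those on all of `cartan`. -/
theorem genWeightSpace_eq (lam : Weight) :
    genWeightSpace M lam = wtSpace M (lam hC) (lam hbarC) := by
  apply le_antisymm
  · exact le_inf (iInf_le _ hC) (iInf_le _ hbarC)
  · refine le_iInf fun x => ?_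
    obtain ⟨a, b, rfl⟩ := cartan_eq x
    have h1 : act M (a • hC + b • hbarC : cartan) = a • act M h + b • act M hbar :=
      act_cartan a b
    rw [h1, map_add, map_smul, map_smul, smul_eq_mul, smul_eq_mul]
    intro v hv
    have h2 := genEigenspace_inf_le_add (a • act M h) (b • act M hbar) (a * lam hC)
      (b * lam hbarC) ⊤ ⊤ ((act_h_comm_hbar.smul_left a).smul_right b)
    exact h2 ⟨genEigenspace_le_smul _ _ _ _ hv.1, genEigenspace_le_smul _ _ _ _ hv.2⟩

/-- Although `hbar` does not commute with `e` and `f`, its brackets with them are multiples of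
`ebar` and `fbar`, with which it does commute. -/
theorem hbar_maxGenEigenspace_stable (c : ℂ) :
    ∀ x ∈ stdBasis, ∀ v ∈ (act M hbar).maxGenEigenspace c,
      inU x • v ∈ (act M hbar).maxGenEigenspace c := by
  apply forall_stdBasis <;> intro v hv
  · refine mapsTo_maxGenEigenspace_of_commutator (D := act M e) (D' := (2 : ℂ) • act M ebar)
      (act_comm_smul (inU_comm_smul lie_hbar_e)) ?_ hv
    rw [mul_smul_comm, smul_mul_assoc, act_comm_zero (inU_comm_zero lie_hbar_ebar)]
  · refine mapsTo_maxGenEigenspace_of_commutator (D := act M f) (D' := (-2 : ℂ) • act M fbar)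
      (act_comm_smul (inU_comm_smul lie_hbar_f)) ?_ hv
    rw [mul_smul_comm, smul_mul_assoc, act_comm_zero (inU_comm_zero lie_hbar_fbar)]
  · exact mapsTo_maxGenEigenspace_of_comm act_h_comm_hbar.symm c hv
  · exact mapsTo_maxGenEigenspace_of_comm (act_comm_zero (inU_comm_zero lie_hbar_ebar)) c hv
  · exact mapsTo_maxGenEigenspace_of_comm (act_comm_zero (inU_comm_zero lie_hbar_fbar)) c hv
  · exact mapsTo_maxGenEigenspace_of_comm (Commute.refl _) c hv

theorem h_maxGenEigenspace_shift {a : ℂ} {v : M} (hv : v ∈ (act M h).maxGenEigenspace a) :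
    inU e • v ∈ (act M h).maxGenEigenspace (a + 2) ∧
    inU f • v ∈ (act M h).maxGenEigenspace (a + -2) ∧
    inU h • v ∈ (act M h).maxGenEigenspace a ∧
    inU ebar • v ∈ (act M h).maxGenEigenspace (a + 2) ∧
    inU fbar • v ∈ (act M h).maxGenEigenspace (a + -2) ∧
    inU hbar • v ∈ (act M h).maxGenEigenspace a :=
  ⟨mapsTo_maxGenEigenspace_add (D := act M e) (act_comm_smul (inU_comm_smul lie_h_e)) hv,
    mapsTo_maxGenEigenspace_add (D := act M f) (act_comm_smul (inU_comm_smul lie_h_f)) hv,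
    mapsTo_maxGenEigenspace_of_comm (Commute.refl _) a hv,
    mapsTo_maxGenEigenspace_add (D := act M ebar) (act_comm_smul (inU_comm_smul lie_h_ebar)) hv,
    mapsTo_maxGenEigenspace_add (D := act M fbar) (act_comm_smul (inU_comm_smul lie_h_fbar)) hv,
    mapsTo_maxGenEigenspace_of_comm act_h_comm_hbar a hv⟩

theorem borelFinite_le_finitePart_h : borelFinite M ≤ finitePart (act M h) :=
  fun _ ⟨W, hW, hvW, hst⟩ => ⟨W, hW, hvW, fun w hw => (hst w hw).2.2.1⟩

theorem borelFinite_le_finitePart_hbar : borelFinite M ≤ finitePart (act M hbar) :=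
  fun _ ⟨W, hW, hvW, hst⟩ => ⟨W, hW, hvW, fun w hw => (hst w hw).2.2.2⟩

theorem iSup_wtSpace (hM : borelFinite M = ⊤) : ⨆ a : ℂ, ⨆ c : ℂ, wtSpace M a c = ⊤ := by
  have h1 : ⨆ a : ℂ, (act M h).maxGenEigenspace a = ⊤ := by
    rw [← finitePart_eq_iSup, eq_top_iff, ← hM]
    exact borelFinite_le_finitePart_h
  rw [eq_top_iff, ← h1]
  refine iSup_mono fun a v hv => ?_
  exact mem_iSup_inf_maxGenEigenspace
    (fun w hw => mapsTo_maxGenEigenspace_of_comm act_h_comm_hbar a hw) hv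
    (borelFinite_le_finitePart_hbar (hM ▸ trivial))

theorem exists_wtSpace_ne_zero (hM : borelFinite M = ⊤) [Nontrivial M] :
    ∃ a c : ℂ, ∃ v ∈ wtSpace M a c, v ≠ 0 := by
  by_contra! hne
  have h1 : ⨆ a : ℂ, ⨆ c : ℂ, wtSpace M a c ≤ ⊥ :=
    iSup_le fun a => iSup_le fun c v hv => (Submodule.mem_bot ℂ).2 (hne a c v hv)
  rw [iSup_wtSpace hM] at h1
  obtain ⟨v, hv⟩ := exists_ne (0 : M)
  exact hv ((Submodule.mem_bot ℂ).1 (h1 (x := v) trivial))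

end WeightSpaces

/-! ### Existence of singular vectors -/

section Singular

/-- A vector killed by `e` and `ebar` on which `h` and `hbar` act by the scalars `a` and `c`. -/
structure IsSingular (a c : ℂ) (v : M) : Prop where
  e_smul : inU e • v = 0
  ebar_smul : inU ebar • v = 0
  h_smul : inU h • v = a • v
  hbar_smul : inU hbar • v = c • v

theorem IsSingular.map {a c : ℂ} {v : M} (hv : IsSingular a c v) (φ : M →ₗ[U] N) :
    IsSingular a c (φ v) where
  e_smul := by rw [← map_smul, hv.e_smul, map_zero]
  ebar_smul := by rw [← map_smul, hv.ebar_smul, map_zero]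
  h_smul := by rw [← map_smul, hv.h_smul]; exact (φ.restrictScalars ℂ).map_smul a v
  hbar_smul := by rw [← map_smul, hv.hbar_smul]; exact (φ.restrictScalars ℂ).map_smul c v

theorem IsSingular.mem_wtSpace {a c : ℂ} {v : M} (hv : IsSingular a c v) : v ∈ wtSpace M a c :=
  ⟨eigenspace_le_maxGenEigenspace (mem_eigenspace_iff.2 hv.h_smul),
    eigenspace_le_maxGenEigenspace (mem_eigenspace_iff.2 hv.hbar_smul)⟩

theorem smul_smul_comm (u : U) (c : ℂ) (v : M) : u • c • v = c • u • v := by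
  rw [← algebraMap_smul U c v, ← algebraMap_smul U c (u • v), ← mul_smul, ← mul_smul,
    Algebra.commutes]

/-- Only the terms `h·hbar + 2hbar` survive, since `e` and `ebar` stand on the right in the others.
-/
theorem IsSingular.casimir_smul {a c : ℂ} {v : M} (hv : IsSingular a c v) :
    casimir • v = (c * (a + 2)) • v := by
  unfold casimir
  have h2 : ∀ w : M, (2 : U) • w = (2 : ℂ) • w := fun w => by
    rw [← algebraMap_smul U (2 : ℂ) w, map_ofNat]
  simp only [add_smul, mul_smul, hv.e_smul, hv.ebar_smul, hv.h_smul, hv.hbar_smul, smul_zero,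
    add_zero, smul_smul_comm, h2]
  module

/-- On a finite dimensional Borel-stable space `ebar` and `e` act nilpotently on `h`-generalized
eigenvectors, since they raise the eigenvalue by 2. Last nonzero iterates of `ebar`, `e`, `h - b`
and `hbar - c`, in this order, give a singular vector; `n` counts the raising steps, and `c` never
changes. -/
theorem exists_isSingular {a c : ℂ} {v : M} (hv : v ∈ wtSpace M a c) (hvf : v ∈ borelFinite M)
    (h0 : v ≠ 0) : ∃ n : ℕ, ∃ w : M, w ≠ 0 ∧ IsSingular (a + 2 * n) c w := by
  let P : M → Prop := fun v => v ∈ borelFinite M ∧ ∃ n : ℕ, v ∈ wtSpace M (a + 2 * n) c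
  have shift : ∀ (n : ℕ) {a' : ℂ}, a' = a + 2 * n + 2 → a' = a + 2 * (n + 1 : ℕ) := by
    rintro n a' rfl
    push_cast
    ring
  have Pebar : ∀ w, P w → P (act M ebar w) := by
    rintro w ⟨hw, n, hn⟩
    refine ⟨borelFinite_stable M ebar (by simp [stdBasis]) w hw, n + 1, ?_,
      hbar_maxGenEigenspace_stable c ebar (by simp [stdBasis]) w hn.2⟩
    rw [← shift n rfl]
    exact (h_maxGenEigenspace_shift hn.1).2.2.2.1
  have Pe : ∀ w, P w → P (act M e w) := by
    rintro w ⟨hw, n, hn⟩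
    refine ⟨borelFinite_stable M e (by simp [stdBasis]) w hw, n + 1, ?_,
      hbar_maxGenEigenspace_stable c e (by simp [stdBasis]) w hn.2⟩
    rw [← shift n rfl]
    exact (h_maxGenEigenspace_shift hn.1).1
  have Pv : P v := ⟨hvf, 0, by simpa using hv⟩
  obtain ⟨v1, hv1, Pv1, hv1e⟩ : ∃ v1 : M, v1 ≠ 0 ∧ P v1 ∧ inU ebar • v1 = 0 := by
    obtain ⟨W, hW, hvW, hst⟩ := hvf
    obtain ⟨n, hn⟩ := exists_pow_apply_eq_zero (T := act M h) (D := act M ebar) two_ne_zero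
      (act_comm_smul (inU_comm_smul lie_h_ebar)) (fun w hw => (hst w hw).2.1) hvW hv.1
    obtain ⟨m, hm, hm'⟩ := exists_pow_apply_ne_zero h0 hn
    exact ⟨_, hm, pow_apply_induction Pebar Pv m, hm'⟩
  obtain ⟨v2, hv2, Pv2, hv2ebar, hv2e⟩ :
      ∃ v2 : M, v2 ≠ 0 ∧ P v2 ∧ inU ebar • v2 = 0 ∧ inU e • v2 = 0 := by
    obtain ⟨⟨W, hW, hvW, hst⟩, n1, hn1⟩ := id Pv1
    obtain ⟨n, hn⟩ := exists_pow_apply_eq_zero (T := act M h) (D := act M e) two_ne_zero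
      (act_comm_smul (inU_comm_smul lie_h_e)) (fun w hw => (hst w hw).1) hvW hn1.1
    obtain ⟨m, hm, hm'⟩ := exists_pow_apply_ne_zero hv1 hn
    -- As `e` commutes with `ebar`, applying `e` does not leave the kernel of `ebar`.
    have := pow_apply_induction (T := act M e) (P := fun w => P w ∧ inU ebar • w = 0)
      (fun w hw => ⟨Pe w hw.1, by
        rw [act_apply, ← smul_comm_zero (inU_comm_zero lie_e_ebar), hw.2, smul_zero]⟩)
      ⟨Pv1, hv1e⟩ m
    exact ⟨_, hm, this.1, this.2, hm'⟩
  obtain ⟨-, n, hn⟩ := Pv2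
  set b : ℂ := a + 2 * n with hb
  let Q : M → Prop := fun w => (inU ebar • w = 0 ∧ inU e • w = 0) ∧ w ∈ wtSpace M b c
  -- It is the common kernel that matters: `[hbar, e] = 2 ebar`, so stability of the kernel of `e`
  -- under `hbar` uses that `ebar` vanishes too.
  have stab : ∀ w : M, (inU ebar • w = 0 ∧ inU e • w = 0) →
      (inU ebar • inU h • w = 0 ∧ inU e • inU h • w = 0) ∧
      (inU ebar • inU hbar • w = 0 ∧ inU e • inU hbar • w = 0) := by
    rintro w ⟨hw1, hw2⟩
    have k1 := smul_comm_smul (inU_comm_smul lie_h_ebar) w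
    have k2 := smul_comm_smul (inU_comm_smul lie_h_e) w
    have k3 := smul_comm_zero (inU_comm_zero lie_hbar_ebar) w
    have k4 := smul_comm_smul (inU_comm_smul lie_hbar_e) w
    simp only [hw1, hw2, smul_zero, add_zero] at k1 k2 k3 k4
    exact ⟨⟨k1.symm, k2.symm⟩, k3.symm, k4.symm⟩
  obtain ⟨v3, hv3, Qv3, hv3h⟩ : ∃ v3 : M, v3 ≠ 0 ∧ Q v3 ∧ inU h • v3 = b • v3 := by
    obtain ⟨k, hk⟩ := (mem_maxGenEigenspace _ _ _).1 hn.1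
    obtain ⟨m, hm, hm'⟩ := exists_pow_apply_ne_zero hv2 hk
    refine ⟨_, hm, pow_apply_induction (P := Q) (fun w hw => ⟨⟨?_, ?_⟩, ?_, ?_⟩)
      ⟨⟨hv2ebar, hv2e⟩, hn⟩ m, sub_eq_zero.1 hm'⟩
    · change inU ebar • (inU h • w - b • w) = 0
      rw [smul_sub, (stab w hw.1).1.1, smul_smul_comm, hw.1.1, smul_zero, sub_zero]
    · change inU e • (inU h • w - b • w) = 0
      rw [smul_sub, (stab w hw.1).1.2, smul_smul_comm, hw.1.2, smul_zero, sub_zero]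
    · exact Submodule.sub_mem _ (h_maxGenEigenspace_shift hw.2.1).2.2.1
        (Submodule.smul_mem _ b hw.2.1)
    · exact Submodule.sub_mem _ (hbar_maxGenEigenspace_stable c h (by simp [stdBasis]) w hw.2.2)
        (Submodule.smul_mem _ b hw.2.2)
  obtain ⟨k, hk⟩ := (mem_maxGenEigenspace _ _ _).1 Qv3.2.2
  obtain ⟨m, hm, hm'⟩ := exists_pow_apply_ne_zero hv3 hk
  have key := pow_apply_induction (T := act M hbar - c • (1 : Module.End ℂ M))
    (P := fun w : M => (inU ebar • w = 0 ∧ inU e • w = 0) ∧ inU h • w = b • w)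
    (fun w hw => ⟨⟨?_, ?_⟩, ?_⟩) ⟨Qv3.1, hv3h⟩ m
  · exact ⟨n, _, hm, key.1.2, key.1.1, key.2, sub_eq_zero.1 hm'⟩
  · change inU ebar • (inU hbar • w - c • w) = 0
    rw [smul_sub, (stab w hw.1).2.1, smul_smul_comm, hw.1.1, smul_zero, sub_zero]
  · change inU e • (inU hbar • w - c • w) = 0
    rw [smul_sub, (stab w hw.1).2.2, smul_smul_comm, hw.1.2, smul_zero, sub_zero]
  · change inU h • (inU hbar • w - c • w) = b • (inU hbar • w - c • w)
    rw [smul_sub, smul_comm_zero (inU_comm_zero lie_h_hbar), smul_smul_comm, hw.2, smul_smul_comm,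
      smul_sub, smul_comm c b]

theorem exists_isSingular_of_nontrivial (hM : borelFinite M = ⊤) [Nontrivial M] :
    ∃ a c : ℂ, ∃ w : M, w ≠ 0 ∧ IsSingular a c w := by
  obtain ⟨a, c, v, hv, h0⟩ := exists_wtSpace_ne_zero hM
  obtain ⟨n, w, hw, hs⟩ := exists_isSingular hv (hM ▸ trivial) h0
  exact ⟨_, c, w, hw, hs⟩

end Singular

/-! ### Joint generalized eigenspaces of `h`, `hbar` and the Casimir element -/

section Casimir

theorem casimir_maxGenEigenspace_stable (d : ℂ) (x : G) {v : M}
    (hv : v ∈ (actCasimir M).maxGenEigenspace d) :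
    inU x • v ∈ (actCasimir M).maxGenEigenspace d :=
  mapsTo_maxGenEigenspace_of_comm (actCasimir_comm x) d hv

/-- The finite part is a submodule. If it were proper, the quotient would contain a singular vector,
on which `casimir` is a scalar; a lift would then lie in the finite part by
`mem_finitePart_of_sub_mem`. No finiteness of weight spaces is needed. -/
theorem finitePart_actCasimir_eq_top (hM : borelFinite M = ⊤) :
    finitePart (actCasimir M) = ⊤ := by
  have hst : ∀ x ∈ stdBasis, ∀ v ∈ finitePart (actCasimir M),
      inU x • v ∈ finitePart (actCasimir M) := by
    intro x _ v hv
    rw [finitePart_eq_iSup] at hv ⊢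
    have h1 : ⨆ d : ℂ, (actCasimir M).maxGenEigenspace d ≤
        (⨆ d : ℂ, (actCasimir M).maxGenEigenspace d).comap (act M x) :=
      iSup_le fun d w hw =>
        Submodule.mem_iSup_of_mem d (casimir_maxGenEigenspace_stable d x hw)
    exact h1 hv
  let K := toUSubmodule _ hst
  by_contra hne
  have hK : K ≠ ⊤ := fun hK => hne (eq_top_iff.2 fun v _ => by
    have : v ∈ K := hK ▸ trivial
    exact this)
  have hnt : Nontrivial (ModuleCat.of U (M ⧸ K)) := Submodule.Quotient.nontrivial_iff.2 hK
  have hQ : borelFinite (ModuleCat.of U (M ⧸ K)) = ⊤ :=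
    borelFinite_eq_top_of_surjective (M := M) (φ := K.mkQ) K.mkQ_surjective hM
  obtain ⟨a, c, w, hw, hs⟩ := exists_isSingular_of_nontrivial hQ
  obtain ⟨v, rfl⟩ := K.mkQ_surjective w
  apply hw
  rw [Submodule.mkQ_apply, Submodule.Quotient.mk_eq_zero]
  refine mem_finitePart_of_sub_mem (c := c * (a + 2)) ?_
  change casimir • v - (c * (a + 2)) • v ∈ K
  rw [← Submodule.Quotient.mk_eq_zero, ← algebraMap_smul U (c * (a + 2)) v,
    Submodule.Quotient.mk_sub, Submodule.Quotient.mk_smul, Submodule.Quotient.mk_smul, sub_eq_zero]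
  have := hs.casimir_smul
  rw [← algebraMap_smul U] at this
  exact this

/-- The simultaneous generalized eigenspace of `h`, `hbar` and the Casimir element. -/
def primary (M : ModuleCat.{0} U) (x : ℂ × ℂ × ℂ) : Submodule ℂ M :=
  wtSpace M x.1 x.2.1 ⊓ (actCasimir M).maxGenEigenspace x.2.2

theorem wtSpace_le_iSup_primary (hM : borelFinite M = ⊤) (a c : ℂ) :
    wtSpace M a c ≤ ⨆ d : ℂ, primary M (a, c, d) := by
  intro v hv
  refine mem_iSup_inf_maxGenEigenspace (p := wtSpace M a c) (fun w hw => ⟨?_, ?_⟩) hv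
    (finitePart_actCasimir_eq_top hM ▸ trivial)
  · exact mapsTo_maxGenEigenspace_of_comm (actCasimir_comm h).symm a hw.1
  · exact mapsTo_maxGenEigenspace_of_comm (actCasimir_comm hbar).symm c hw.2

theorem iSup_primary (hM : borelFinite M = ⊤) : ⨆ x, primary M x = ⊤ := by
  rw [eq_top_iff, ← iSup_wtSpace hM]
  refine iSup_le fun a => iSup_le fun c => (wtSpace_le_iSup_primary hM a c).trans ?_
  exact iSup_le fun d => le_iSup (primary M) (a, c, d)

theorem iSupIndep_primary (M : ModuleCat.{0} U) : iSupIndep (primary M) := by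
  let g : Fin 3 → Module.End ℂ M := ![act M h, act M hbar, actCasimir M]
  have hg : ∀ i j, Commute (g i) (g j) := by
    intro i j
    fin_cases i <;> fin_cases j
    exacts [Commute.refl _, act_h_comm_hbar, (actCasimir_comm h).symm, act_h_comm_hbar.symm,
      Commute.refl _, (actCasimir_comm hbar).symm, actCasimir_comm h, actCasimir_comm hbar,
      Commute.refl _]
  have h1 := independent_iInf_maxGenEigenspace_of_forall_mapsTo g
    fun i j φ => mapsTo_maxGenEigenspace_of_comm (hg j i) φ
  have hinj : Function.Injective fun x : ℂ × ℂ × ℂ => ![x.1, x.2.1, x.2.2] := by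
    rintro ⟨a, c, d⟩ ⟨a', c', d'⟩ hx
    have e0 := congrFun hx 0
    have e1 := congrFun hx 1
    have e2 := congrFun hx 2
    simp only [Matrix.cons_val] at e0 e1 e2
    rw [e0, e1, e2]
  refine (h1.comp hinj).mono fun x => ?_
  refine le_iInf fun i => ?_
  fin_cases i
  exacts [inf_le_left.trans inf_le_left, inf_le_left.trans inf_le_right, inf_le_right]

theorem map_mem_primary (φ : M →ₗ[U] N) {x : ℂ × ℂ × ℂ} {v : M} (hv : v ∈ primary M x) :
    φ v ∈ primary N x :=
  ⟨⟨map_mem_maxGenEigenspace (φ := φ.restrictScalars ℂ) (fun v => φ.map_smul _ v) hv.1.1,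
    map_mem_maxGenEigenspace (φ := φ.restrictScalars ℂ) (fun v => φ.map_smul _ v) hv.1.2⟩,
    map_mem_maxGenEigenspace (φ := φ.restrictScalars ℂ) (fun v => φ.map_smul _ v) hv.2⟩

theorem IsSingular.mem_primary {a c : ℂ} {v : M} (hv : IsSingular a c v) :
    v ∈ primary M (a, c, c * (a + 2)) :=
  ⟨hv.mem_wtSpace, eigenspace_le_maxGenEigenspace (mem_eigenspace_iff.2 hv.casimir_smul)⟩

end Casimir

end

end Takiff

namespace Takiff

noncomputable section

open scoped ModuleCat

open Module.End

variable {M N : ModuleCat.{0} U}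

/-! ### Objects of thick category `𝒪` are Noetherian -/

section Noetherian

theorem exists_isBorelStable_of_finset (hM : borelFinite M = ⊤) (s : Finset M) :
    ∃ W : Submodule ℂ M, FiniteDimensional ℂ W ∧ (s : Set M) ⊆ W ∧ IsBorelStable W := by
  classical
  induction s using Finset.induction_on with
  | empty => exact ⟨⊥, inferInstance, by simp, by simp [IsBorelStable]⟩
  | insert v s _ ih =>
    obtain ⟨W, hW, hs, hst⟩ := ih
    obtain ⟨W', hW', hv, hst'⟩ : v ∈ borelFinite M := hM ▸ trivial
    refine ⟨W ⊔ W', inferInstance, ?_, hst.sup hst'⟩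
    rw [Finset.coe_insert, Set.insert_subset_iff]
    exact ⟨Submodule.mem_sup_right hv, hs.trans fun x hx => Submodule.mem_sup_left hx⟩

/-- The commutative subalgebra of `U(𝔤)` generated by `f` and `fbar`. -/
abbrev lowerAlgebra : Subalgebra ℂ U := Algebra.adjoin ℂ {inU f, inU fbar}

theorem f_mem_lowerAlgebra : inU f ∈ lowerAlgebra := Algebra.subset_adjoin (by simp)

theorem fbar_mem_lowerAlgebra : inU fbar ∈ lowerAlgebra := Algebra.subset_adjoin (by simp)

instance isMulCommutative_lowerAlgebra : IsMulCommutative lowerAlgebra := by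
  refine Algebra.isMulCommutative_adjoin ℂ ?_
  have := inU_comm_zero lie_f_fbar
  rintro x (rfl | rfl) y (rfl | rfl)
  exacts [rfl, this, this.symm, rfl]

open scoped IsMulCommutative in
instance isNoetherianRing_lowerAlgebra : IsNoetherianRing lowerAlgebra := by
  have : Algebra.FiniteType ℂ lowerAlgebra := by
    rw [← Subalgebra.fg_iff_finiteType]
    exact Subalgebra.fg_def.2 ⟨_, by simp, rfl⟩
  exact Algebra.FiniteType.isNoetherianRing ℂ lowerAlgebra

/-- The subspace generated by `W` under the lowering operators. -/
def lowerSpan (W : Submodule ℂ M) : Submodule ℂ M :=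
  (Submodule.span lowerAlgebra (W : Set M)).restrictScalars ℂ

theorem smul_mem_lowerSpan {W : Submodule ℂ M} {u : U} (hu : u ∈ lowerAlgebra) {v : M}
    (hv : v ∈ lowerSpan W) : u • v ∈ lowerSpan W :=
  Submodule.smul_mem (Submodule.span lowerAlgebra (W : Set M)) ⟨u, hu⟩ hv

/-- This plays the role of `U(𝔤) = U(𝔫₋) U(𝔟)`: the vectors lying in some Borel-stable subspace of
`lowerSpan W` form a `𝔤`-submodule, because `lower` enlarges such a subspace to another one
containing its images under `f` and `fbar`. -/
theorem lowerSpan_eq_top {W : Submodule ℂ M} (hW : IsBorelStable W)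
    (htop : Submodule.span U (W : Set M) = ⊤) : lowerSpan W = ⊤ := by
  let K : Submodule ℂ M :=
    { carrier := {v | ∃ W' : Submodule ℂ M, v ∈ W' ∧ IsBorelStable W' ∧ W' ≤ lowerSpan W}
      zero_mem' := ⟨⊥, by simp, by simp [IsBorelStable], bot_le⟩
      add_mem' := by
        rintro v v' ⟨W₁, h1, h2, h3⟩ ⟨W₂, k1, k2, k3⟩
        exact ⟨W₁ ⊔ W₂, Submodule.add_mem_sup h1 k1, h2.sup k2, sup_le h3 k3⟩
      smul_mem' := by
        rintro c v ⟨W₁, h1, h2, h3⟩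
        exact ⟨W₁, W₁.smul_mem c h1, h2, h3⟩ }
  have hlow : ∀ W' : Submodule ℂ M, W' ≤ lowerSpan W → lower W' ≤ lowerSpan W := by
    intro W' h
    refine sup_le (sup_le h ?_) ?_ <;> rintro _ ⟨w, hw, rfl⟩
    · exact smul_mem_lowerSpan f_mem_lowerAlgebra (h hw)
    · exact smul_mem_lowerSpan fbar_mem_lowerAlgebra (h hw)
  have hst : ∀ x ∈ stdBasis, ∀ v ∈ K, inU x • v ∈ K := by
    apply forall_stdBasis <;> rintro v ⟨W', h1, h2, h3⟩
    · exact ⟨W', (h2 v h1).1, h2, h3⟩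
    · exact ⟨lower W', f_smul_mem_lower h1, h2.lower, hlow W' h3⟩
    · exact ⟨W', (h2 v h1).2.2.1, h2, h3⟩
    · exact ⟨W', (h2 v h1).2.1, h2, h3⟩
    · exact ⟨lower W', fbar_smul_mem_lower h1, h2.lower, hlow W' h3⟩
    · exact ⟨W', (h2 v h1).2.2.2, h2, h3⟩
  have h1 : Submodule.span U (W : Set M) ≤ toUSubmodule K hst :=
    Submodule.span_le.2 fun w hw => ⟨W, hw, hW, fun x hx => Submodule.subset_span hx⟩
  rw [htop] at h1
  rw [eq_top_iff]
  intro v _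
  obtain ⟨W', k1, -, k3⟩ := h1 (x := v) trivial
  exact k3 k1

/-- A finite dimensional Borel-stable generating space generates `M` already over the commutative
algebra of `f` and `fbar`, which is Noetherian by Hilbert's basis theorem. -/
theorem isNoetherian_of_borelFinite [Module.Finite U M] (hM : borelFinite M = ⊤) :
    IsNoetherian U M := by
  obtain ⟨s, hs⟩ := (Module.finite_def (R := U) (M := M)).1 inferInstance
  obtain ⟨W, hW, hsW, hst⟩ := exists_isBorelStable_of_finset hM s
  have h1 : Submodule.span U (W : Set M) = ⊤ :=
    eq_top_iff.2 (hs ▸ Submodule.span_mono hsW)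
  have h2 := lowerSpan_eq_top hst h1
  obtain ⟨t, ht⟩ := (Submodule.fg_top W).1 (Module.finite_def.1 hW)
  have h3 : Module.Finite lowerAlgebra M := by
    refine Module.finite_def.2 ⟨t, ?_⟩
    rw [eq_top_iff]
    have h4 : Submodule.span lowerAlgebra (W : Set M) ≤ Submodule.span lowerAlgebra (t : Set M) := by
      refine Submodule.span_le.2 fun w hw => ?_
      rw [SetLike.mem_coe, ← ht] at hw
      exact Submodule.span_le_restrictScalars ℂ lowerAlgebra (t : Set M) hw
    intro v _
    exact h4 (show v ∈ lowerSpan W from h2 ▸ trivial)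
  have h5 : IsNoetherian lowerAlgebra M := inferInstance
  exact isNoetherian_of_tower lowerAlgebra h5

end Noetherian

/-! ### Closure properties of both categories -/

section Closure

theorem thickO_iff : thickO M ↔ Module.Finite U M ∧ borelFinite M = ⊤ :=
  ⟨fun hM => ⟨hM.1, hM.2.borelFinite_eq_top⟩,
    fun hM => ⟨hM.1, isLocallyFinite_of_borelFinite_eq_top le_rfl hM.2⟩⟩

/-- Generalized eigenspaces are independent, so if the smaller eigenspaces already span, the two
families agree. The elementwise form passes to submodules and products. -/
theorem iSup_eigenspace_eq_top_iff {V : Type*} [AddCommGroup V] [Module ℂ V]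
    {T : Module.End ℂ V} (hT : ⨆ a : ℂ, T.maxGenEigenspace a = ⊤) :
    ⨆ a : ℂ, T.eigenspace a = ⊤ ↔ ∀ a, ∀ v ∈ T.maxGenEigenspace a, T v = a • v := by
  constructor
  · intro h1 a v hv
    have h2 := ((independent_maxGenEigenspace T).le_iff_eq_of_iSup_eq_top h1).1
      fun a => eigenspace_le_maxGenEigenspace
    rw [← congrFun h2 a] at hv
    exact mem_eigenspace_iff.1 hv
  · intro h1
    rw [eq_top_iff, ← hT]
    exact iSup_mono fun a v hv => mem_eigenspace_iff.2 (h1 a v hv)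

theorem iSup_maxGenEigenspace_h (hM : borelFinite M = ⊤) :
    ⨆ a : ℂ, (act M h).maxGenEigenspace a = ⊤ := by
  rw [← finitePart_eq_iSup, eq_top_iff, ← hM]
  exact borelFinite_le_finitePart_h

theorem classicalO_iff : classicalO M ↔ thickO M ∧
    ∀ a, ∀ v ∈ (act M h).maxGenEigenspace a, inU h • v = a • v := by
  constructor
  · rintro ⟨h1, -, h2⟩
    exact ⟨h1, (iSup_eigenspace_eq_top_iff (iSup_maxGenEigenspace_h (thickO_iff.1 h1).2)).1 h2⟩
  · rintro ⟨h1, h2⟩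
    have hb := (thickO_iff.1 h1).2
    exact ⟨h1, isLocallyFinite_of_borelFinite_eq_top le_sup_left hb,
      (iSup_eigenspace_eq_top_iff (iSup_maxGenEigenspace_h hb)).2 h2⟩

theorem map_mem_h_maxGenEigenspace (φ : M →ₗ[U] N) {a : ℂ} {v : M}
    (hv : v ∈ (act M h).maxGenEigenspace a) : φ v ∈ (act N h).maxGenEigenspace a :=
  map_mem_maxGenEigenspace (φ := φ.restrictScalars ℂ) (fun v => φ.map_smul _ v) hv

theorem map_complex_smul (φ : M →ₗ[U] N) (a : ℂ) (v : M) : φ (a • v) = a • φ v :=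
  (φ.restrictScalars ℂ).map_smul a v

/-- The properties shared by classical and thick category `𝒪`. -/
structure IsCategoryO (X : ObjectProperty (ModuleCat.{0} U)) : Prop where
  thick : ∀ {M : ModuleCat.{0} U}, X M → thickO M
  of_injective : ∀ {M N : ModuleCat.{0} U} (φ : M →ₗ[U] N), Function.Injective φ → X N → X M
  of_surjective : ∀ {M N : ModuleCat.{0} U} (φ : M →ₗ[U] N), Function.Surjective φ → X M → X N
  pi : ∀ {J : Type} [Finite J] (A : J → ModuleCat.{0} U), (∀ j, X (A j)) →
    X (ModuleCat.of U (∀ j, A j))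
  of_classical : ∀ {M : ModuleCat.{0} U}, classicalO M → X M

theorem isCategoryO_thickO : IsCategoryO thickO where
  thick h := h
  of_injective {M N} φ hφ hN := by
    obtain ⟨h1, h2⟩ := thickO_iff.1 hN
    have := isNoetherian_of_borelFinite h2
    have := isNoetherian_of_injective φ hφ
    exact thickO_iff.2 ⟨inferInstance, borelFinite_eq_top_of_injective hφ h2⟩
  of_surjective {M N} φ hφ hM := by
    obtain ⟨h1, h2⟩ := thickO_iff.1 hM
    exact thickO_iff.2 ⟨Module.Finite.of_surjective φ hφ, borelFinite_eq_top_of_surjective hφ h2⟩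
  pi {J} _ A hA := by
    classical
    have := Fintype.ofFinite J
    have h1 : ∀ j, Module.Finite U (A j) := fun j => (thickO_iff.1 (hA j)).1
    refine thickO_iff.2 ⟨Module.Finite.pi, eq_top_iff.2 fun v _ => ?_⟩
    have hv : v = ∑ j, (LinearMap.single U (fun j => A j) j) (v j) := by
      ext i
      simp [Finset.sum_apply]
    rw [hv]
    refine Submodule.sum_mem _ fun j _ => ?_
    exact map_mem_borelFinite (N := ModuleCat.of U (∀ j, A j)) (LinearMap.single U (fun j => A j) j)
      ((thickO_iff.1 (hA j)).2 ▸ trivial)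
  of_classical h := h.1

theorem isCategoryO_classicalO : IsCategoryO classicalO where
  thick h := h.1
  of_injective {M N} φ hφ hN := by
    obtain ⟨h1, h2⟩ := classicalO_iff.1 hN
    refine classicalO_iff.2 ⟨isCategoryO_thickO.of_injective φ hφ h1, fun a v hv => hφ ?_⟩
    rw [map_smul, map_complex_smul]
    exact h2 a _ (map_mem_h_maxGenEigenspace φ hv)
  of_surjective {M N} φ hφ hM := by
    have h1 := isCategoryO_thickO.of_surjective φ hφ hM.1
    refine ⟨h1, isLocallyFinite_of_borelFinite_eq_top le_sup_left (thickO_iff.1 h1).2, ?_⟩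
    have h2 : (⨆ a : ℂ, (act M h).eigenspace a).map (φ.restrictScalars ℂ) = ⊤ := by
      rw [hM.2.2, Submodule.map_top, LinearMap.range_eq_top]
      exact hφ
    rw [eq_top_iff, ← h2, Submodule.map_iSup]
    refine iSup_mono fun a => ?_
    rintro _ ⟨v, hv, rfl⟩
    rw [mem_eigenspace_iff]
    have hv' : inU h • v = a • v := mem_eigenspace_iff.1 hv
    change inU h • φ v = a • φ v
    rw [← map_smul, hv', map_complex_smul]
  pi {J} _ A hA := by
    refine classicalO_iff.2 ⟨isCategoryO_thickO.pi A fun j => (hA j).1, fun a v hv => ?_⟩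
    funext j
    have h1 := (classicalO_iff.1 (hA j)).2 a _ (map_mem_h_maxGenEigenspace
      (M := ModuleCat.of U (∀ j, A j)) (LinearMap.proj j : (∀ j, A j) →ₗ[U] A j) hv)
    have h2 := map_complex_smul (M := ModuleCat.of U (∀ j, A j))
      (LinearMap.proj j : (∀ j, A j) →ₗ[U] A j) a v
    exact h1.trans h2.symm
  of_classical h := h

theorem primary_ne_bot_of_injective {φ : M →ₗ[U] N} (hφ : Function.Injective φ) {x : ℂ × ℂ × ℂ}
    (hx : primary M x ≠ ⊥) : primary N x ≠ ⊥ := by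
  obtain ⟨v, hv, h0⟩ := Submodule.exists_mem_ne_zero_of_ne_bot hx
  exact (Submodule.ne_bot_iff _).2 ⟨φ v, map_mem_primary φ hv, (map_ne_zero_iff φ hφ).2 h0⟩

/-- The images of the spaces `primary M x` span `N` and lie in the independent spaces `primary N x`,
so they fill them. -/
theorem primary_ne_bot_of_surjective (hM : borelFinite M = ⊤) {φ : M →ₗ[U] N}
    (hφ : Function.Surjective φ) {x : ℂ × ℂ × ℂ} (hx : primary N x ≠ ⊥) : primary M x ≠ ⊥ := by
  have h1 : ⨆ x, (primary M x).map (φ.restrictScalars ℂ) = ⊤ := by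
    rw [← Submodule.map_iSup, iSup_primary hM, Submodule.map_top, LinearMap.range_eq_top]
    exact hφ
  have h2 := ((iSupIndep_primary N).le_iff_eq_of_iSup_eq_top h1).1 (by
    rintro x _ ⟨v, hv, rfl⟩
    exact map_mem_primary φ hv)
  intro h3
  rw [← congrFun h2 x, h3, Submodule.map_bot] at hx
  exact hx rfl

end Closure

end

end Takiff

namespace Takiff

noncomputable section

open scoped ModuleCat

open Module.End

variable {M N : ModuleCat.{0} U}

/-! ### Modules generated by a singular vector -/

section Lowering

theorem eq_top_of_generator {v : M} (hgen : ∀ K : Submodule U M, v ∈ K → K = ⊤)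
    {p : Submodule ℂ M} (hp : ∀ x ∈ stdBasis, ∀ w ∈ p, inU x • w ∈ p) (hv : v ∈ p) : p = ⊤ := by
  have h1 := hgen (toUSubmodule p hp) hv
  rw [eq_top_iff]
  intro w _
  have h2 : w ∈ toUSubmodule p hp := h1 ▸ trivial
  exact h2

/-- The span of the monomials of degree `n - 1` in `f` and `fbar` applied to `v`. -/
def layer (v : M) : ℕ → Submodule ℂ M
  | 0 => ⊥
  | 1 => ℂ ∙ v
  | n + 2 => (layer v (n + 1)).map (act M f) ⊔ (layer v (n + 1)).map (act M fbar)

theorem f_smul_mem_layer {v : M} {n : ℕ} {w : M} (hw : w ∈ layer v n) :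
    inU f • w ∈ layer v (n + 1) := by
  cases n with
  | zero =>
    rw [layer, Submodule.mem_bot] at hw
    simp [hw]
  | succ n => exact Submodule.mem_sup_left ⟨w, hw, rfl⟩

theorem fbar_smul_mem_layer {v : M} {n : ℕ} {w : M} (hw : w ∈ layer v n) :
    inU fbar • w ∈ layer v (n + 1) := by
  cases n with
  | zero =>
    rw [layer, Submodule.mem_bot] at hw
    simp [hw]
  | succ n => exact Submodule.mem_sup_right ⟨w, hw, rfl⟩

theorem layer_induction {v : M} {P : ℕ → M → Prop}
    (hadd : ∀ n x y, P n x → P n y → P n (x + y)) (h1 : ∀ r : ℂ, P 0 (r • v))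
    (hf : ∀ n, ∀ w ∈ layer v (n + 1), P n w → P (n + 1) (inU f • w))
    (hfbar : ∀ n, ∀ w ∈ layer v (n + 1), P n w → P (n + 1) (inU fbar • w)) (n : ℕ) :
    ∀ w ∈ layer v (n + 1), P n w := by
  induction n with
  | zero =>
    intro w hw
    obtain ⟨r, rfl⟩ := Submodule.mem_span_singleton.1 hw
    exact h1 r
  | succ n ih =>
    intro w hw
    obtain ⟨_, ⟨y, hy, rfl⟩, _, ⟨z, hz, rfl⟩, rfl⟩ := Submodule.mem_sup.1 hw
    exact hadd _ _ _ (hf n y hy (ih y hy)) (hfbar n z hz (ih z hz))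

variable {a c : ℂ} {v : M}

theorem IsSingular.h_smul_layer (hv : IsSingular a c v) (n : ℕ) :
    ∀ w ∈ layer v (n + 1), inU h • w = (a - 2 * n) • w := by
  refine layer_induction (P := fun n w => inU h • w = (a - 2 * n) • w) ?_ ?_ ?_ ?_ n
  · intro n x y hx hy
    rw [smul_add, smul_add, hx, hy]
  · intro r
    rw [smul_smul_comm, hv.h_smul, smul_comm]
    simp
  · intro n w _ hw
    rw [smul_comm_smul (inU_comm_smul lie_h_f), hw, smul_smul_comm, ← add_smul]
    push_cast
    ring_nf
  · intro n w _ hw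
    rw [smul_comm_smul (inU_comm_smul lie_h_fbar), hw, smul_smul_comm, ← add_smul]
    push_cast
    ring_nf

theorem IsSingular.hbar_smul_layer (hv : IsSingular a c v) (n : ℕ) :
    ∀ w ∈ layer v (n + 1), inU hbar • w ∈ layer v (n + 1) := by
  refine layer_induction (P := fun n w => inU hbar • w ∈ layer v (n + 1)) ?_ ?_ ?_ ?_ n
  · intro n x y hx hy
    rw [smul_add]
    exact Submodule.add_mem _ hx hy
  · intro r
    rw [smul_smul_comm, hv.hbar_smul]
    exact Submodule.smul_mem _ _ (Submodule.smul_mem _ _ (Submodule.mem_span_singleton_self v))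
  · intro n w hw' hw
    rw [smul_comm_smul (inU_comm_smul lie_hbar_f)]
    exact Submodule.add_mem _ (f_smul_mem_layer hw)
      (Submodule.smul_mem _ _ (fbar_smul_mem_layer hw'))
  · intro n w _ hw
    rw [smul_comm_zero (inU_comm_zero lie_hbar_fbar)]
    exact fbar_smul_mem_layer hw

/-- The index shift in `layer`, with `layer v 0 = ⊥` and `layer v 1` the line of `v`, lets the
raising operators lower the index uniformly, also on `v` itself. -/
theorem IsSingular.e_smul_layer (hv : IsSingular a c v) (n : ℕ) :
    ∀ w ∈ layer v (n + 1), inU e • w ∈ layer v n := by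
  refine layer_induction (P := fun n w => inU e • w ∈ layer v n) ?_ ?_ ?_ ?_ n
  · intro n x y hx hy
    rw [smul_add]
    exact Submodule.add_mem _ hx hy
  · intro r
    rw [smul_smul_comm, hv.e_smul, smul_zero]
    exact Submodule.zero_mem _
  · intro n w hw' hw
    rw [smul_comm_of (inU_comm lie_e_f), hv.h_smul_layer n w hw']
    exact Submodule.add_mem _ (f_smul_mem_layer hw) (Submodule.smul_mem _ _ hw')
  · intro n w hw' hw
    rw [smul_comm_of (inU_comm lie_e_fbar)]
    exact Submodule.add_mem _ (fbar_smul_mem_layer hw) (hv.hbar_smul_layer n w hw')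

theorem IsSingular.ebar_smul_layer (hv : IsSingular a c v) (n : ℕ) :
    ∀ w ∈ layer v (n + 1), inU ebar • w ∈ layer v n := by
  refine layer_induction (P := fun n w => inU ebar • w ∈ layer v n) ?_ ?_ ?_ ?_ n
  · intro n x y hx hy
    rw [smul_add]
    exact Submodule.add_mem _ hx hy
  · intro r
    rw [smul_smul_comm, hv.ebar_smul, smul_zero]
    exact Submodule.zero_mem _
  · intro n w hw' hw
    rw [smul_comm_of (inU_comm lie_ebar_f)]
    exact Submodule.add_mem _ (f_smul_mem_layer hw) (hv.hbar_smul_layer n w hw')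
  · intro n w hw' hw
    rw [smul_comm_zero (inU_comm_zero lie_ebar_fbar)]
    exact fbar_smul_mem_layer hw

/-- A module generated by a singular vector is the sum of the layers. -/
theorem IsSingular.iSup_layer (hv : IsSingular a c v)
    (hgen : ∀ K : Submodule U M, v ∈ K → K = ⊤) : ⨆ n, layer v (n + 1) = ⊤ := by
  have key : ∀ x : G, (∀ n, ∀ w ∈ layer v (n + 1), inU x • w ∈ ⨆ n, layer v (n + 1)) →
      ∀ w ∈ ⨆ n, layer v (n + 1), inU x • w ∈ ⨆ n, layer v (n + 1) := by
    intro x hx w hw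
    have h1 : ⨆ n, layer v (n + 1) ≤ (⨆ n, layer v (n + 1)).comap (act M x) :=
      iSup_le fun n w hw => hx n w hw
    exact h1 hw
  have hup : ∀ n, layer v n ≤ ⨆ n, layer v (n + 1) := by
    rintro (_ | n)
    · exact bot_le
    · exact le_iSup (fun n => layer v (n + 1)) n
  refine eq_top_of_generator hgen ?_ (hup 1 (Submodule.mem_span_singleton_self v))
  apply forall_stdBasis <;> apply key <;> intro n w hw
  · exact hup _ (hv.e_smul_layer n w hw)
  · exact hup _ (f_smul_mem_layer hw)
  · rw [hv.h_smul_layer n w hw]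
    exact hup _ (Submodule.smul_mem _ _ hw)
  · exact hup _ (hv.ebar_smul_layer n w hw)
  · exact hup _ (fbar_smul_mem_layer hw)
  · exact hup _ (hv.hbar_smul_layer n w hw)

/-- The layers lie in eigenspaces for distinct eigenvalues and together span `M`, so they exhaust
the generalized eigenspaces. For `n = 0` the highest weight space is a line. -/
theorem IsSingular.layer_eq (hv : IsSingular a c v)
    (hgen : ∀ K : Submodule U M, v ∈ K → K = ⊤) (n : ℕ) :
    layer v (n + 1) = (act M h).maxGenEigenspace (a - 2 * n) := by
  have hinj : Function.Injective fun n : ℕ => a - 2 * n := by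
    intro m n hmn
    have : (m : ℂ) = n := by
      linear_combination (-1 / 2 : ℂ) * hmn
    exact_mod_cast this
  have h1 := (((independent_maxGenEigenspace (act M h)).comp hinj).le_iff_eq_of_iSup_eq_top
    (hv.iSup_layer hgen)).1
    fun n w hw => eigenspace_le_maxGenEigenspace (mem_eigenspace_iff.2 (hv.h_smul_layer n w hw))
  exact congrFun h1 n

theorem IsSingular.mem_span_of_mem (hv : IsSingular a c v)
    (hgen : ∀ K : Submodule U M, v ∈ K → K = ⊤) {w : M}
    (hw : w ∈ (act M h).maxGenEigenspace a) : ∃ r : ℂ, r • v = w := by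
  have h1 := hv.layer_eq hgen 0
  rw [Nat.cast_zero, mul_zero, sub_zero] at h1
  rw [← h1] at hw
  exact Submodule.mem_span_singleton.1 hw

theorem IsSingular.mem_of_mem (hv : IsSingular a c v)
    (hgen : ∀ K : Submodule U M, v ∈ K → K = ⊤) {w : M}
    (hw : w ∈ (act M h).maxGenEigenspace a) (h0 : w ≠ 0) {K : Submodule U M} (hK : w ∈ K) :
    v ∈ K := by
  obtain ⟨r, rfl⟩ := hv.mem_span_of_mem hgen hw
  have hr : r ≠ 0 := by
    rintro rfl
    exact h0 (zero_smul ℂ v)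
  have h1 : algebraMap ℂ U r⁻¹ • r • v = v := by
    rw [algebraMap_smul, smul_smul, inv_mul_cancel₀ hr, one_smul]
  rw [← h1]
  exact K.smul_mem _ hK

theorem IsSingular.borelFinite_eq_top (hv : IsSingular a c v)
    (hgen : ∀ K : Submodule U M, v ∈ K → K = ⊤) : borelFinite M = ⊤ := by
  refine eq_top_of_generator hgen (borelFinite_stable M)
    ⟨ℂ ∙ v, inferInstance, Submodule.mem_span_singleton_self v, ?_⟩
  intro w hw
  obtain ⟨r, rfl⟩ := Submodule.mem_span_singleton.1 hw
  simp only [smul_smul_comm, hv.e_smul, hv.ebar_smul, hv.h_smul, hv.hbar_smul, smul_zero]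
  have := Submodule.mem_span_singleton_self (R := ℂ) v
  exact ⟨Submodule.zero_mem _, Submodule.zero_mem _, Submodule.smul_mem _ _
    (Submodule.smul_mem _ _ this), Submodule.smul_mem _ _ (Submodule.smul_mem _ _ this)⟩

theorem IsSingular.classicalO (hv : IsSingular a c v)
    (hgen : ∀ K : Submodule U M, v ∈ K → K = ⊤) : classicalO M := by
  have hb := hv.borelFinite_eq_top hgen
  have hfin : Module.Finite U M := by
    refine Module.finite_def.2 ⟨{v}, hgen _ ?_⟩
    exact Submodule.subset_span (by simp)
  refine ⟨thickO_iff.2 ⟨hfin, hb⟩, isLocallyFinite_of_borelFinite_eq_top le_sup_left hb, ?_⟩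
  rw [eq_top_iff, ← hv.iSup_layer hgen]
  refine iSup_le fun n w hw => ?_
  exact Submodule.mem_iSup_of_mem _ (mem_eigenspace_iff.2 (hv.h_smul_layer n w hw))

/-- The generalized eigenspaces of `hbar` and `casimir` containing `v` are submodules, hence all of
`M`; the eigenvalues of `h` are those of the layers. -/
theorem IsSingular.eq_of_primary_ne_bot (hv : IsSingular a c v)
    (hgen : ∀ K : Submodule U M, v ∈ K → K = ⊤) {x : ℂ × ℂ × ℂ} (hx : primary M x ≠ ⊥) :
    (∃ n : ℕ, x.1 = a - 2 * n) ∧ x.2.1 = c ∧ x.2.2 = c * (a + 2) := by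
  obtain ⟨w, ⟨⟨hw1, hw2⟩, hw3⟩, h0⟩ := Submodule.exists_mem_ne_zero_of_ne_bot hx
  have hmem : ∀ {T : Module.End ℂ M} {s t : ℂ}, T.maxGenEigenspace s = ⊤ →
      w ∈ T.maxGenEigenspace t → t = s := by
    intro T s t hs ht
    by_contra hne
    have h1 := disjoint_genEigenspace T hne ⊤ ⊤
    exact h0 (Submodule.disjoint_def.1 h1 w ht (show w ∈ T.maxGenEigenspace s from hs ▸ trivial))
  refine ⟨?_, hmem ?_ hw2, hmem ?_ hw3⟩
  · by_contra! hne
    have h1 : Disjoint ((act M h).maxGenEigenspace x.1) (⨆ n, layer v (n + 1)) := by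
      refine ((independent_maxGenEigenspace (act M h)) x.1).mono_right (iSup_le fun n => ?_)
      rw [hv.layer_eq hgen n]
      exact le_iSup₂_of_le (f := fun b (_ : b ≠ x.1) => (act M h).maxGenEigenspace b)
        (a - 2 * n) (hne n).symm le_rfl
    rw [hv.iSup_layer hgen] at h1
    exact h0 (Submodule.disjoint_def.1 h1 w hw1 trivial)
  · exact eq_top_of_generator hgen (hbar_maxGenEigenspace_stable c) hv.mem_wtSpace.2
  · exact eq_top_of_generator hgen
      (fun x _ w hw => casimir_maxGenEigenspace_stable (c * (a + 2)) x hw) hv.mem_primary.2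

/-- For `c = 0` the bracket `[e, fbar] = hbar` kills `v`. This is the source of the maps between
Verma modules in a coset block. -/
theorem IsSingular.fbar_smul (hv : IsSingular a 0 v) : IsSingular (a - 2) 0 (inU fbar • v) where
  e_smul := by
    rw [smul_comm_of (inU_comm lie_e_fbar), hv.e_smul, hv.hbar_smul, smul_zero, zero_smul,
      add_zero]
  ebar_smul := by rw [smul_comm_zero (inU_comm_zero lie_ebar_fbar), hv.ebar_smul, smul_zero]
  h_smul := by
    rw [smul_comm_smul (inU_comm_smul lie_h_fbar), hv.h_smul, smul_smul_comm, ← add_smul]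
    ring_nf
  hbar_smul := by
    rw [smul_comm_zero (inU_comm_zero lie_hbar_fbar), hv.hbar_smul, smul_smul_comm]

theorem IsSingular.fbar_pow_smul (hv : IsSingular a 0 v) (n : ℕ) :
    IsSingular (a - 2 * n) 0 (inU fbar ^ n • v) := by
  induction n with
  | zero => simpa using hv
  | succ n ih =>
    rw [pow_succ', mul_smul]
    convert ih.fbar_smul using 1
    push_cast
    ring

theorem IsSingular.hbar_smul_fbar_pow (hv : IsSingular a c v) (n : ℕ) :
    inU hbar • inU fbar ^ n • v = c • inU fbar ^ n • v := by
  induction n with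
  | zero => simpa using hv.hbar_smul
  | succ n ih =>
    rw [pow_succ', mul_smul, smul_comm_zero (inU_comm_zero lie_hbar_fbar), ih, smul_smul_comm]

theorem IsSingular.h_smul_fbar_pow (hv : IsSingular a c v) (n : ℕ) :
    inU h • inU fbar ^ n • v = (a - 2 * n) • inU fbar ^ n • v := by
  induction n with
  | zero => simpa using hv.h_smul
  | succ n ih =>
    rw [pow_succ', mul_smul, smul_comm_smul (inU_comm_smul lie_h_fbar), ih, smul_smul_comm, ← add_smul]
    push_cast
    ring_nf

/-- Moving `e` through `n + 1` factors `fbar` leaves `hbar` once at each place, and `hbar` commutes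
with `fbar`. For `c ≠ 0` it follows that no power of `fbar` kills `v`. -/
theorem IsSingular.e_smul_fbar_pow (hv : IsSingular a c v) (n : ℕ) :
    inU e • inU fbar ^ (n + 1) • v = ((n + 1) * c) • inU fbar ^ n • v := by
  induction n with
  | zero =>
    rw [zero_add, pow_one, pow_zero, one_smul, smul_comm_of (inU_comm lie_e_fbar), hv.e_smul,
      hv.hbar_smul]
    simp
  | succ n ih =>
    rw [pow_succ' _ (n + 1), mul_smul, smul_comm_of (inU_comm lie_e_fbar), ih,
      hv.hbar_smul_fbar_pow, smul_smul_comm, ← mul_smul, ← pow_succ', ← add_smul]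
    push_cast
    ring_nf

theorem IsSingular.fbar_pow_smul_ne_zero (hv : IsSingular a c v) (hc : c ≠ 0) (h0 : v ≠ 0)
    (n : ℕ) : inU fbar ^ n • v ≠ 0 := by
  induction n with
  | zero => simpa using h0
  | succ n ih =>
    intro h1
    have h2 := hv.e_smul_fbar_pow n
    rw [h1, smul_zero] at h2
    have h3 : ((n + 1 : ℂ) * c) ≠ 0 := mul_ne_zero (by exact_mod_cast n.succ_ne_zero) hc
    exact (smul_ne_zero h3 ih) h2.symm

theorem IsSingular.fbar_pow_smul_mem (hv : IsSingular a c v) (n : ℕ) :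
    inU fbar ^ n • v ∈ wtSpace M (a - 2 * n) c :=
  ⟨eigenspace_le_maxGenEigenspace (mem_eigenspace_iff.2 (hv.h_smul_fbar_pow n)),
    eigenspace_le_maxGenEigenspace (mem_eigenspace_iff.2 (hv.hbar_smul_fbar_pow n))⟩

end Lowering

end

end Takiff

namespace Takiff

noncomputable section

open scoped ModuleCat

open Module.End

/-! ### An explicit module with a singular vector of arbitrary weight -/

section Model

/-- Shift of the first index, i.e. multiplication of a power series in two variables by the first
variable. -/
def shiftFst : Module.End ℂ (ℕ → ℕ → ℂ) where
  toFun u i j := match i with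
    | 0 => 0
    | i + 1 => u i j
  map_add' u w := by
    ext i j
    cases i <;> simp
  map_smul' r u := by
    ext i j
    cases i <;> simp

/-- Shift of the second index, i.e. multiplication of a power series in two variables by the
second variable. -/
def shiftSnd : Module.End ℂ (ℕ → ℕ → ℂ) where
  toFun u i j := match j with
    | 0 => 0
    | j + 1 => u i j
  map_add' u w := by
    ext i j
    cases j <;> simp
  map_smul' r u := by
    ext i j
    cases j <;> simp

@[simp] theorem shiftFst_zero (u : ℕ → ℕ → ℂ) (j : ℕ) : shiftFst u 0 j = 0 := rfl

@[simp] theorem shiftFst_succ (u : ℕ → ℕ → ℂ) (i j : ℕ) : shiftFst u (i + 1) j = u i j := rfl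

@[simp] theorem shiftSnd_zero (u : ℕ → ℕ → ℂ) (i : ℕ) : shiftSnd u i 0 = 0 := rfl

@[simp] theorem shiftSnd_succ (u : ℕ → ℕ → ℂ) (i j : ℕ) : shiftSnd u i (j + 1) = u i j := rfl

/-- The action of `h` on power series in two variables. -/
def modelH (a : ℂ) : Module.End ℂ (ℕ → ℕ → ℂ) where
  toFun u i j := (a - 2 * i - 2 * j) * u i j
  map_add' u w := by
    ext i j
    simp only [Pi.add_apply]
    ring
  map_smul' r u := by
    ext i j
    simp only [Pi.smul_apply, smul_eq_mul, RingHom.id_apply]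
    ring

/-- The action of `hbar` on power series in two variables. -/
def modelHbar (c : ℂ) : Module.End ℂ (ℕ → ℕ → ℂ) where
  toFun u i j := c * u i j - 2 * (i + 1) * shiftSnd u (i + 1) j
  map_add' u w := by
    ext i j
    simp only [Pi.add_apply, map_add]
    ring
  map_smul' r u := by
    ext i j
    simp only [Pi.smul_apply, smul_eq_mul, RingHom.id_apply, map_smul]
    ring

/-- The action of `e` on power series in two variables. -/
def modelE (a c : ℂ) : Module.End ℂ (ℕ → ℕ → ℂ) where
  toFun u i j := (i + 1) * (a - i - 2 * j) * u (i + 1) j + c * (j + 1) * u i (j + 1)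
  map_add' u w := by
    ext i j
    simp only [Pi.add_apply]
    ring
  map_smul' r u := by
    ext i j
    simp only [Pi.smul_apply, smul_eq_mul, RingHom.id_apply]
    ring

/-- The action of `ebar` on power series in two variables. -/
def modelEbar (c : ℂ) : Module.End ℂ (ℕ → ℕ → ℂ) where
  toFun u i j := c * (i + 1) * u (i + 1) j - (i + 2) * (i + 1) * shiftSnd u (i + 2) j
  map_add' u w := by
    ext i j
    simp only [Pi.add_apply, map_add]
    ring
  map_smul' r u := by
    ext i j
    simp only [Pi.smul_apply, smul_eq_mul, RingHom.id_apply, map_smul]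
    ring

theorem modelH_apply (a : ℂ) (u : ℕ → ℕ → ℂ) (i j : ℕ) :
    modelH a u i j = (a - 2 * i - 2 * j) * u i j := rfl

theorem modelHbar_apply (c : ℂ) (u : ℕ → ℕ → ℂ) (i j : ℕ) :
    modelHbar c u i j = c * u i j - 2 * (i + 1) * shiftSnd u (i + 1) j := rfl

theorem modelE_apply (a c : ℂ) (u : ℕ → ℕ → ℂ) (i j : ℕ) : modelE a c u i j =
    (i + 1) * (a - i - 2 * j) * u (i + 1) j + c * (j + 1) * u i (j + 1) := rfl

theorem modelEbar_apply (c : ℂ) (u : ℕ → ℕ → ℂ) (i j : ℕ) : modelEbar c u i j =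
    c * (i + 1) * u (i + 1) j - (i + 2) * (i + 1) * shiftSnd u (i + 2) j := rfl

variable (a c : ℂ)

/-- The model copies the action on the vectors `f^i fbar^j v` of a Verma module. With `f = x` and
`fbar = y`, the operators are `h = a - 2x∂x - 2y∂y`, `hbar = c - 2y∂x`, `e = a∂x - x∂x² - 2y∂x∂y +
c∂y` and `ebar = c∂x - y∂x²`. This and the next fourteen identities are the brackets of the six
operators. -/
theorem modelE_mul_shiftFst :
    modelE a c * shiftFst = shiftFst * modelE a c + modelH a := by
  ext u i j
  cases i <;>
    simp [modelH_apply, modelE_apply]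
  ring

theorem modelE_mul_shiftSnd :
    modelE a c * shiftSnd = shiftSnd * modelE a c + modelHbar c := by
  ext u i j
  cases j <;>
    simp [modelHbar_apply, modelE_apply]
  ring

theorem modelEbar_mul_shiftFst :
    modelEbar c * shiftFst = shiftFst * modelEbar c + modelHbar c := by
  ext u i j
  cases i <;> cases j <;>
    simp [modelHbar_apply, modelEbar_apply] <;> ring

theorem modelEbar_mul_shiftSnd : modelEbar c * shiftSnd = shiftSnd * modelEbar c := by
  ext u i j
  cases j <;>
    simp [modelEbar_apply]

theorem modelH_mul_modelE :
    modelH a * modelE a c = modelE a c * modelH a + (2 : ℂ) • modelE a c := by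
  ext u i j
  simp [modelH_apply, modelE_apply]
  ring

theorem modelH_mul_shiftFst : modelH a * shiftFst = shiftFst * modelH a + (-2 : ℂ) • shiftFst := by
  ext u i j
  cases i <;>
    simp [modelH_apply]
  ring

theorem modelH_mul_modelEbar :
    modelH a * modelEbar c = modelEbar c * modelH a + (2 : ℂ) • modelEbar c := by
  ext u i j
  cases j <;>
    simp [modelH_apply, modelEbar_apply] <;> ring

theorem modelH_mul_shiftSnd : modelH a * shiftSnd = shiftSnd * modelH a + (-2 : ℂ) • shiftSnd := by
  ext u i j
  cases j <;>
    simp [modelH_apply]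
  ring

theorem modelHbar_mul_modelE :
    modelHbar c * modelE a c = modelE a c * modelHbar c + (2 : ℂ) • modelEbar c := by
  ext u i j
  cases j <;>
    simp [modelHbar_apply, modelE_apply, modelEbar_apply] <;> ring

theorem modelHbar_mul_shiftFst :
    modelHbar c * shiftFst = shiftFst * modelHbar c + (-2 : ℂ) • shiftSnd := by
  ext u i j
  cases i <;> cases j <;>
    simp [modelHbar_apply]
  ring

theorem modelHbar_mul_modelEbar : modelHbar c * modelEbar c = modelEbar c * modelHbar c := by
  ext u i j
  rcases j with _ | _ | j <;>
    simp [modelHbar_apply, modelEbar_apply] <;> ring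

theorem modelHbar_mul_shiftSnd : modelHbar c * shiftSnd = shiftSnd * modelHbar c := by
  ext u i j
  cases j <;>
    simp [modelHbar_apply]

theorem modelH_mul_modelHbar : modelH a * modelHbar c = modelHbar c * modelH a := by
  ext u i j
  cases j <;>
    simp [modelHbar_apply, modelH_apply] <;> ring

theorem modelE_mul_modelEbar : modelE a c * modelEbar c = modelEbar c * modelE a c := by
  ext u i j
  cases j <;>
    simp [modelE_apply, modelEbar_apply] <;> ring

theorem shiftFst_mul_shiftSnd : shiftFst * shiftSnd = shiftSnd * shiftFst := by
  ext u i j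
  cases i <;> cases j <;> simp

attribute [local instance] LieRing.ofAssociativeRing LieAlgebra.ofAssociativeAlgebra

/-- The linear map underlying the action of `𝔤` on power series in two variables. -/
def modelLinear : G →ₗ[ℂ] Module.End ℂ (ℕ → ℕ → ℂ) :=
  TensorProduct.lift (LinearMap.mk₂ ℂ
    (fun (p : DualNumber ℂ) (A : SL2) =>
      p.fst • (A.1 0 0 • modelH a + A.1 0 1 • modelE a c + A.1 1 0 • shiftFst) +
      p.snd • (A.1 0 0 • modelHbar c + A.1 0 1 • modelEbar c + A.1 1 0 • shiftSnd))
    (fun p q A => by simp only [TrivSqZeroExt.fst_add, TrivSqZeroExt.snd_add]; module)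
    (fun r p A => by
      simp only [TrivSqZeroExt.fst_smul, TrivSqZeroExt.snd_smul, smul_eq_mul]; module)
    (fun p A B => by
      have h1 : (A + B).1 = A.1 + B.1 := rfl
      simp only [h1, Matrix.add_apply]; module)
    (fun r p A => by
      have h1 : (r • A).1 = r • A.1 := rfl
      simp only [h1, Matrix.smul_apply, smul_eq_mul]; module))

theorem modelLinear_tmul (p : DualNumber ℂ) (A : SL2) : modelLinear a c (p ⊗ₜ A) =
    p.fst • (A.1 0 0 • modelH a + A.1 0 1 • modelE a c + A.1 1 0 • shiftFst) +
    p.snd • (A.1 0 0 • modelHbar c + A.1 0 1 • modelEbar c + A.1 1 0 • shiftSnd) := rfl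

theorem sl_lie_apply (A B : SL2) : (⁅A, B⁆ : SL2).1 0 0 = A.1 0 1 * B.1 1 0 - B.1 0 1 * A.1 1 0 ∧
    (⁅A, B⁆ : SL2).1 0 1 = 2 * (A.1 0 0 * B.1 0 1 - B.1 0 0 * A.1 0 1) ∧
    (⁅A, B⁆ : SL2).1 1 0 = 2 * (A.1 1 0 * B.1 0 0 - B.1 1 0 * A.1 0 0) := by
  have h1 : (⁅A, B⁆ : SL2).1 = A.1 * B.1 - B.1 * A.1 := rfl
  rw [h1]
  simp only [Matrix.sub_apply, Matrix.mul_apply, Fin.sum_univ_two, sl_apply_one_one]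
  refine ⟨?_, ?_, ?_⟩ <;> ring

/-- By bilinearity only pure tensors matter; there the fifteen relations bring all products into one
fixed order, and coefficients are compared. -/
theorem modelLinear_lie (x y : G) : modelLinear a c ⁅x, y⁆ =
    modelLinear a c x * modelLinear a c y - modelLinear a c y * modelLinear a c x := by
  induction x using TensorProduct.induction_on with
  | zero =>
    have h1 : ⁅(0 : G), y⁆ = 0 := zero_lie (L := G) y
    rw [h1, map_zero, zero_mul, mul_zero, sub_zero]
  | add x x' hx hx' =>
    have h1 : ⁅x + x', y⁆ = ⁅x, y⁆ + ⁅x', y⁆ := add_lie (L := G) x x' y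
    rw [h1, map_add, map_add, hx, hx']
    noncomm_ring
  | tmul p A =>
    induction y using TensorProduct.induction_on with
    | zero =>
      have h1 : ⁅p ⊗ₜ[ℂ] A, (0 : G)⁆ = 0 := lie_zero (L := G) _
      rw [h1, map_zero, zero_mul, mul_zero, sub_zero]
    | add y y' hy hy' =>
      have h1 : ⁅p ⊗ₜ[ℂ] A, y + y'⁆ = ⁅p ⊗ₜ[ℂ] A, y⁆ + ⁅p ⊗ₜ[ℂ] A, y'⁆ :=
        lie_add (L := G) _ y y'
      rw [h1, map_add, map_add, hy, hy']
      noncomm_ring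
    | tmul q B =>
      obtain ⟨k1, k2, k3⟩ := sl_lie_apply A B
      rw [LieAlgebra.ExtendScalars.bracket_tmul, modelLinear_tmul, modelLinear_tmul,
        modelLinear_tmul, k1, k2, k3]
      simp only [TrivSqZeroExt.fst_mul, TrivSqZeroExt.snd_mul, smul_eq_mul,
        MulOpposite.smul_eq_mul_unop, MulOpposite.unop_op,
        smul_add, mul_add, add_mul, smul_mul_assoc, mul_smul_comm, modelE_mul_shiftFst,
        modelE_mul_shiftSnd, modelEbar_mul_shiftFst, modelEbar_mul_shiftSnd, modelH_mul_modelE,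
        modelH_mul_shiftFst, modelH_mul_modelEbar, modelH_mul_shiftSnd, modelHbar_mul_modelE,
        modelHbar_mul_shiftFst, modelHbar_mul_modelEbar, modelHbar_mul_shiftSnd,
        modelH_mul_modelHbar, modelE_mul_modelEbar, shiftFst_mul_shiftSnd]
      module

/-- The action of `U(𝔤)` on power series in two variables. -/
def modelHom : U →ₐ[ℂ] Module.End ℂ (ℕ → ℕ → ℂ) :=
  UniversalEnvelopingAlgebra.lift ℂ
    { modelLinear a c with
      map_lie' := fun {x y} => modelLinear_lie a c x y }

theorem modelHom_inU (x : G) : modelHom a c (inU x) = modelLinear a c x :=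
  UniversalEnvelopingAlgebra.lift_ι_apply ℂ _ x

/-- The action of `𝔤` on power series in two variables, as an object. -/
def modelModule : ModuleCat.{0} U :=
  @ModuleCat.of U _ (ℕ → ℕ → ℂ) _ (Module.compHom _ (modelHom a c).toRingHom)

theorem inU_smul_model (x : G) (u : modelModule a c) :
    (inU x • u : modelModule a c) = modelLinear a c x u := by
  rw [← modelHom_inU]
  rfl

theorem complex_smul_model (r : ℂ) (u : modelModule a c) :
    (r • u : modelModule a c) = fun i j => r * u i j := by
  rw [← algebraMap_smul U r u]
  change modelHom a c (algebraMap ℂ U r) u = _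
  rw [AlgHom.commutes]
  rfl

theorem modelLinear_h : modelLinear a c h = modelH a := by
  rw [h, modelLinear_tmul]
  simp [slH]

theorem modelLinear_hbar : modelLinear a c hbar = modelHbar c := by
  rw [hbar, modelLinear_tmul]
  simp [slH]

theorem modelLinear_e : modelLinear a c e = modelE a c := by
  rw [e, modelLinear_tmul]
  simp [slE]

theorem modelLinear_ebar : modelLinear a c ebar = modelEbar c := by
  rw [ebar, modelLinear_tmul]
  simp [slE]

theorem modelLinear_fbar : modelLinear a c fbar = shiftSnd := by
  rw [fbar, modelLinear_tmul]
  simp [slF]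

/-- The `n`-th power of the second variable. -/
def sndPow (n : ℕ) : ℕ → ℕ → ℂ := fun i j => if i = 0 ∧ j = n then 1 else 0

/-- The `n`-th power of the second variable, as an element of the module. -/
def modelMonomial (n : ℕ) : modelModule a c := sndPow n

theorem modelE_sndPow : modelE a c (sndPow 0) = 0 := by
  ext i j
  simp [modelE_apply, sndPow]

theorem modelEbar_sndPow : modelEbar c (sndPow 0) = 0 := by
  ext i j
  cases j <;> simp [modelEbar_apply, sndPow]

theorem modelH_sndPow : modelH a (sndPow 0) = fun i j => a * sndPow 0 i j := by
  ext i j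
  by_cases hij : i = 0 ∧ j = 0
  · obtain ⟨rfl, rfl⟩ := hij
    simp [modelH_apply]
  · simp [modelH_apply, sndPow, hij]

theorem modelHbar_sndPow : modelHbar c (sndPow 0) = fun i j => c * sndPow 0 i j := by
  ext i j
  cases j <;> simp [modelHbar_apply, sndPow]

theorem shiftSnd_sndPow (n : ℕ) : shiftSnd (sndPow n) = sndPow (n + 1) := by
  ext i j
  cases j <;> simp [sndPow]

theorem isSingular_modelMonomial : IsSingular a c (modelMonomial a c 0) where
  e_smul := by
    rw [inU_smul_model, modelLinear_e]
    exact modelE_sndPow a c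
  ebar_smul := by
    rw [inU_smul_model, modelLinear_ebar]
    exact modelEbar_sndPow c
  h_smul := by
    rw [inU_smul_model, modelLinear_h, complex_smul_model]
    exact modelH_sndPow a
  hbar_smul := by
    rw [inU_smul_model, modelLinear_hbar, complex_smul_model]
    exact modelHbar_sndPow c

theorem fbar_pow_smul_modelMonomial (n : ℕ) :
    inU fbar ^ n • modelMonomial a c 0 = modelMonomial a c n := by
  induction n with
  | zero => simp
  | succ n ih =>
    rw [pow_succ', mul_smul, ih, inU_smul_model, modelLinear_fbar]
    exact shiftSnd_sndPow n

theorem modelMonomial_ne_zero (n : ℕ) : modelMonomial a c n ≠ 0 := by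
  intro h0
  have := congrFun (congrFun h0 0) n
  change (if 0 = 0 ∧ n = n then (1 : ℂ) else 0) = 0 at this
  simp at this

end Model

end

end Takiff

namespace Takiff

noncomputable section

open scoped ModuleCat

open Module.End

variable {M N : ModuleCat.{0} U}

/-! ### Verma modules and their simplicity for `lam(hbar) ≠ 0` -/

section VermaModules

attribute [local instance] LieRing.ofAssociativeRing LieAlgebra.ofAssociativeAlgebra

/-- The Verma module as an object. -/
abbrev vermaModule (lam : Weight) : ModuleCat.{0} U := ModuleCat.of U (Verma lam)

/-- The canonical generator of the Verma module. -/
def vermaGen (lam : Weight) : vermaModule lam := (vermaIdeal lam).mkQ 1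

variable (lam : Weight)

theorem smul_vermaGen (u : U) : u • vermaGen lam = (vermaIdeal lam).mkQ u := by
  rw [vermaGen, ← map_smul, smul_eq_mul, mul_one]

theorem vermaGen_generates (K : Submodule U (vermaModule lam)) (hK : vermaGen lam ∈ K) :
    K = ⊤ := by
  rw [eq_top_iff]
  intro x _
  obtain ⟨u, rfl⟩ := (vermaIdeal lam).mkQ_surjective x
  have h1 := K.smul_mem u hK
  rw [smul_vermaGen] at h1
  exact h1

theorem smul_vermaGen_eq_zero {u : U} (hu : u ∈ vermaIdeal lam) : u • vermaGen lam = 0 := by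
  rw [smul_vermaGen, Submodule.mkQ_apply]
  exact (Submodule.Quotient.mk_eq_zero _).2 hu

theorem cartan_smul_vermaGen (x : cartan) : inU x • vermaGen lam = lam x • vermaGen lam := by
  have h1 : inU (x : G) - algebraMap ℂ U (lam x) ∈ vermaIdeal lam :=
    Submodule.subset_span (Or.inr ⟨x, rfl⟩)
  have h2 := smul_vermaGen_eq_zero lam h1
  rw [sub_smul, sub_eq_zero, algebraMap_smul] at h2
  exact h2

theorem nPlus_smul_vermaGen {x : G} (hx : x ∈ nPlus) : inU x • vermaGen lam = 0 :=
  smul_vermaGen_eq_zero lam (Submodule.subset_span (Or.inl ⟨x, hx, rfl⟩))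

theorem isSingular_vermaGen : IsSingular (lam hC) (lam hbarC) (vermaGen lam) where
  e_smul := nPlus_smul_vermaGen lam (LieSubalgebra.subset_lieSpan (by simp))
  ebar_smul := nPlus_smul_vermaGen lam (LieSubalgebra.subset_lieSpan (by simp))
  h_smul := cartan_smul_vermaGen lam hC
  hbar_smul := cartan_smul_vermaGen lam hbarC

/-- The Lie algebra elements killing a vector. -/
def lieAnnihilator (v : M) : LieSubalgebra ℂ G where
  carrier := {x | inU x • v = 0}
  zero_mem' := by simp
  add_mem' {x y} hx hy := by
    change inU (x + y) • v = 0
    have h1 : inU (x + y) = inU x + inU y := map_add _ x y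
    rw [h1, add_smul, show inU x • v = 0 from hx, show inU y • v = 0 from hy, add_zero]
  smul_mem' r x hx := by
    change inU (r • x) • v = 0
    have h1 : inU (r • x) = r • inU x := map_smul _ r x
    rw [h1, smul_assoc, show inU x • v = 0 from hx, smul_zero]
  lie_mem' {x y} hx hy := by
    change inU ⁅x, y⁆ • v = 0
    rw [inU_lie, sub_smul, mul_smul, mul_smul, show inU x • v = 0 from hx,
      show inU y • v = 0 from hy, smul_zero, smul_zero, sub_zero]

variable {lam}

theorem vermaIdeal_le {v : M} (hv : IsSingular (lam hC) (lam hbarC) v) :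
    vermaIdeal lam ≤ LinearMap.ker (LinearMap.toSpanSingleton U M v) := by
  have h1 : nPlus ≤ lieAnnihilator v := by
    refine LieSubalgebra.lieSpan_le.2 ?_
    rintro x (rfl | rfl)
    exacts [hv.e_smul, hv.ebar_smul]
  refine Submodule.span_le.2 (Set.union_subset ?_ ?_)
  · rintro _ ⟨x, hx, rfl⟩
    exact h1 hx
  · rintro _ ⟨x, rfl⟩
    change (inU (x : G) - algebraMap ℂ U (lam x)) • v = 0
    obtain ⟨r, s, rfl⟩ := cartan_eq x
    have h2 : inU ((r • hC + s • hbarC : cartan) : G) = r • inU h + s • inU hbar := by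
      change inU (r • h + s • hbar) = _
      simp
    rw [h2, sub_smul, add_smul, smul_assoc, smul_assoc, hv.h_smul, hv.hbar_smul, algebraMap_smul,
      map_add, map_smul, map_smul, smul_eq_mul, smul_eq_mul]
    module

/-- The homomorphism from a Verma module given by a singular vector. -/
def vermaLift {v : M} (hv : IsSingular (lam hC) (lam hbarC) v) : vermaModule lam →ₗ[U] M :=
  (vermaIdeal lam).liftQ _ (vermaIdeal_le hv)

theorem vermaLift_vermaGen {v : M} (hv : IsSingular (lam hC) (lam hbarC) v) :
    vermaLift hv (vermaGen lam) = v := by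
  change (1 : U) • v = v
  rw [one_smul]

/-- Under the map to the model, `fbar^n` applied to the generator becomes the monomial `y^n`. -/
theorem fbar_pow_smul_vermaGen_ne_zero (n : ℕ) : inU fbar ^ n • vermaGen lam ≠ 0 := by
  intro h0
  have h1 := congrArg (vermaLift (isSingular_modelMonomial (lam hC) (lam hbarC))) h0
  rw [map_smul, vermaLift_vermaGen, fbar_pow_smul_modelMonomial, map_zero] at h1
  exact modelMonomial_ne_zero _ _ n h1

theorem vermaGen_ne_zero : vermaGen lam ≠ 0 := by
  simpa using fbar_pow_smul_vermaGen_ne_zero (lam := lam) 0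

instance nontrivial_vermaModule : Nontrivial (vermaModule lam) :=
  ⟨⟨_, _, vermaGen_ne_zero⟩⟩

theorem classicalO_vermaModule : classicalO (vermaModule lam) :=
  (isSingular_vermaGen lam).classicalO (vermaGen_generates lam)

theorem borelFinite_vermaModule : borelFinite (vermaModule lam) = ⊤ :=
  (isSingular_vermaGen lam).borelFinite_eq_top (vermaGen_generates lam)

/-- A proper nonzero submodule contains a singular vector, whose `hbar` and Casimir eigenvalues are
those of the generator. Cancelling `c ≠ 0` in `c(a + 2)` gives it the highest weight, so it is a
multiple of the generator. -/
theorem isSimpleModule_verma (hlam : lam hbarC ≠ 0) : IsSimpleModule U (vermaModule lam) := by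
  refine (isSimpleModule_iff U _).2
    { exists_pair_ne := (inferInstance : Nontrivial (Submodule U (vermaModule lam))).1
      eq_bot_or_eq_top := fun K => ?_ }
  by_contra! hK
  have hnt : Nontrivial (ModuleCat.of U K) := Submodule.nontrivial_iff_ne_bot.2 hK.1
  have hb : borelFinite (ModuleCat.of U K) = ⊤ :=
    borelFinite_eq_top_of_injective (N := vermaModule lam) (φ := K.subtype) K.injective_subtype
      borelFinite_vermaModule
  obtain ⟨a, c, w, hw, hs⟩ := exists_isSingular_of_nontrivial hb
  have hs' : IsSingular a c (w : vermaModule lam) := hs.map (N := vermaModule lam) K.subtype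
  have hw' : (w : vermaModule lam) ≠ 0 := fun h0 => hw (Subtype.ext h0)
  obtain ⟨-, h1, h2⟩ := (isSingular_vermaGen lam).eq_of_primary_ne_bot (vermaGen_generates lam)
    ((Submodule.ne_bot_iff _).2 ⟨_, hs'.mem_primary, hw'⟩)
  simp only at h1 h2
  have h3 : a = lam hC := by
    rw [h1] at h2
    have := mul_left_cancel₀ hlam h2
    linear_combination this
  subst h3
  exact hK.2 (vermaGen_generates lam K ((isSingular_vermaGen lam).mem_of_mem
    (vermaGen_generates lam) hs'.mem_wtSpace.1 hw' w.2))

theorem nonempty_verma_equiv_L (hlam : lam hbarC ≠ 0) :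
    Nonempty (vermaModule lam ≃ₗ[U] L lam) := by
  have h1 := isSimpleModule_verma hlam
  have h2 : sSup {N : Submodule U (Verma lam) | N ≠ ⊤} = ⊥ := by
    rw [sSup_eq_bot]
    intro K hK
    exact ((isSimpleModule_iff U _).1 h1).eq_bot_or_eq_top K |>.resolve_right hK
  exact ⟨(Submodule.quotEquivOfEqBot _ h2).symm⟩

theorem nonempty_equiv_L_of_isSingular [IsSimpleModule U M] {v : M} (hlam : lam hbarC ≠ 0)
    (hv : IsSingular (lam hC) (lam hbarC) v) (h0 : v ≠ 0) : Nonempty (M ≃ₗ[U] L lam) := by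
  have h1 := isSimpleModule_verma hlam
  have h2 : vermaLift hv ≠ 0 := by
    intro h
    have := vermaLift_vermaGen hv
    rw [h, LinearMap.zero_apply] at this
    exact h0 this.symm
  obtain ⟨φ⟩ := nonempty_verma_equiv_L hlam
  exact ⟨(LinearEquiv.ofBijective _ (LinearMap.bijective_of_ne_zero h2)).symm.trans φ⟩

end VermaModules

end

end Takiff

namespace Takiff

noncomputable section

open scoped ModuleCat

open Module.End

variable {M N : ModuleCat.{0} U}

/-! ### Block indices and the decomposition of a module by index -/

section BlockIndices

/-- The weight with value `a` on `h` that vanishes on `hbar`. -/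
def wtZero (a : ℂ) : weightsZero := ⟨wt a 0, wt_hbarC a 0⟩

theorem mk_wtZero_add (a : ℂ) (n : ℤ) :
    (QuotientAddGroup.mk (wtZero (a + 2 * n)) : Coset) = QuotientAddGroup.mk (wtZero a) := by
  rw [eq_comm, QuotientAddGroup.eq, AddSubgroup.mem_zmultiples_iff]
  refine ⟨n, Subtype.ext (weight_ext ?_ ?_)⟩
  · change (n • alpha) hC = (-wt a 0 + wt (a + 2 * n) 0) hC
    rw [LinearMap.smul_apply, LinearMap.add_apply, LinearMap.neg_apply, alpha_hC, wt_hC, wt_hC,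
      zsmul_eq_mul]
    ring
  · change (n • alpha) hbarC = (-wt a 0 + wt (a + 2 * n) 0) hbarC
    rw [LinearMap.smul_apply, LinearMap.add_apply, LinearMap.neg_apply, alpha_hbarC, wt_hbarC,
      wt_hbarC]
    simp

theorem exists_eq_add_of_mk_wtZero_eq {a b : ℂ}
    (hab : (QuotientAddGroup.mk (wtZero a) : Coset) = QuotientAddGroup.mk (wtZero b)) :
    ∃ n : ℤ, b = a + 2 * n := by
  rw [QuotientAddGroup.eq, AddSubgroup.mem_zmultiples_iff] at hab
  obtain ⟨n, hn⟩ := hab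
  refine ⟨n, ?_⟩
  have h1 : (n • alpha) hC = (-wt a 0 + wt b 0) hC :=
    congrArg (fun mu : weightsZero => (mu : Weight) hC) hn
  rw [LinearMap.smul_apply, LinearMap.add_apply, LinearMap.neg_apply, alpha_hC, wt_hC, wt_hC,
    zsmul_eq_mul] at h1
  linear_combination -h1

open Classical in
/-- The block containing a simultaneous generalized eigenvector of `h`, `hbar` and the Casimir
element with the given eigenvalues. -/
def blockIndex (x : ℂ × ℂ × ℂ) : BlockIndex :=
  -- For `c ≠ 0` the highest weight `a` is the solution of `d = c(a + 2)`, and the given eigenvalue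
  -- of `h` plays no role; for `c = 0` it is `d` that plays no role.
  if hc : x.2.1 ≠ 0 then Sum.inl ⟨wt (x.2.2 / x.2.1 - 2) x.2.1, by rwa [wt_hbarC]⟩
  else Sum.inr (QuotientAddGroup.mk (wtZero x.1))

theorem blockIndex_zero (a d : ℂ) :
    blockIndex (a, 0, d) = Sum.inr (QuotientAddGroup.mk (wtZero a)) := by
  simp [blockIndex]

theorem blockIndex_of_ne {c : ℂ} (hc : c ≠ 0) (a d : ℂ) :
    blockIndex (a, c, d) = Sum.inl ⟨wt (d / c - 2) c, by rwa [wt_hbarC]⟩ := by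
  simp [blockIndex, hc]

/-- Hence the index is unchanged by the action of `𝔤`, which makes the components submodules. -/
theorem blockIndex_add (a c d : ℂ) (n : ℤ) :
    blockIndex (a + 2 * n, c, d) = blockIndex (a, c, d) := by
  by_cases hc : c = 0
  · subst hc
    rw [blockIndex_zero, blockIndex_zero, mk_wtZero_add]
  · rw [blockIndex_of_ne hc, blockIndex_of_ne hc]

/-- The block containing the Verma module of a given highest weight. -/
def wtIndex (lam : Weight) : BlockIndex :=
  blockIndex (lam hC, lam hbarC, lam hbarC * (lam hC + 2))

theorem blockIndex_singular (a c : ℂ) : blockIndex (a, c, c * (a + 2)) = wtIndex (wt a c) := by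
  rw [wtIndex, wt_hC, wt_hbarC]

theorem wtIndex_of_ne {lam : Weight} (hlam : lam hbarC ≠ 0) :
    wtIndex lam = Sum.inl ⟨lam, hlam⟩ := by
  rw [wtIndex, blockIndex_of_ne hlam]
  congr 2
  refine weight_ext ?_ ?_
  · rw [wt_hC, mul_div_cancel_left₀ _ hlam]
    ring
  · rw [wt_hbarC]

theorem wtIndex_of_mem (mu : weightsZero) :
    wtIndex mu = Sum.inr (QuotientAddGroup.mk mu) := by
  have h0 : (mu : Weight) hbarC = 0 := mu.2
  rw [wtIndex, h0, blockIndex_zero]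
  congr 2
  refine Subtype.ext (weight_ext ?_ ?_)
  · exact wt_hC _ _
  · exact (wt_hbarC _ _).trans h0.symm

theorem wtIndex_surjective (i : BlockIndex) : ∃ lam, wtIndex lam = i := by
  obtain ⟨lam, hlam⟩ | xi := i
  · exact ⟨lam, wtIndex_of_ne hlam⟩
  · obtain ⟨mu, rfl⟩ := QuotientAddGroup.mk_surjective xi
    exact ⟨mu, wtIndex_of_mem mu⟩

/-- Weights with the same block index agree up to a multiple of `α`, and agree if they do not
vanish on `hbar`. -/
theorem eq_or_of_wtIndex_eq {lam mu : Weight} (hlm : wtIndex lam = wtIndex mu) :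
    lam = mu ∨ (lam hbarC = 0 ∧ mu hbarC = 0 ∧ ∃ n : ℤ, mu hC = lam hC + 2 * n) := by
  by_cases h1 : lam hbarC = 0 <;> by_cases h2 : mu hbarC = 0
  · right
    rw [wtIndex, wtIndex, h1, h2, blockIndex_zero, blockIndex_zero, Sum.inr.injEq] at hlm
    exact ⟨h1, h2, exists_eq_add_of_mk_wtZero_eq hlm⟩
  · rw [wtIndex_of_ne h2, wtIndex, h1, blockIndex_zero] at hlm
    cases hlm
  · rw [wtIndex_of_ne h1, wtIndex, h2, blockIndex_zero] at hlm
    cases hlm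
  · left
    rw [wtIndex_of_ne h1, wtIndex_of_ne h2] at hlm
    simpa using hlm

/-- All generalized eigenspaces of `M` belong to the block `i`. -/
def HasIndex (i : BlockIndex) (M : ModuleCat.{0} U) : Prop :=
  ∀ x, primary M x ≠ ⊥ → blockIndex x = i

theorem HasIndex.of_injective {i : BlockIndex} (hN : HasIndex i N) {φ : M →ₗ[U] N}
    (hφ : Function.Injective φ) : HasIndex i M :=
  fun x hx => hN x (primary_ne_bot_of_injective hφ hx)

theorem HasIndex.of_surjective {i : BlockIndex} (hM : HasIndex i M) (hb : borelFinite M = ⊤)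
    {φ : M →ₗ[U] N} (hφ : Function.Surjective φ) : HasIndex i N :=
  fun x hx => hM x (primary_ne_bot_of_surjective hb hφ hx)

theorem HasIndex.pi {i : BlockIndex} {J : Type} {A : J → ModuleCat.{0} U}
    (hA : ∀ j, HasIndex i (A j)) : HasIndex i (ModuleCat.of U (∀ j, A j)) := by
  intro x hx
  obtain ⟨v, hv, h0⟩ := Submodule.exists_mem_ne_zero_of_ne_bot hx
  obtain ⟨j, hj⟩ := Function.ne_iff.1 h0
  exact hA j x ((Submodule.ne_bot_iff _).2 ⟨v j, map_mem_primary (M := ModuleCat.of U (∀ j, A j))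
    (LinearMap.proj j : (∀ j, A j) →ₗ[U] A j) hv, hj⟩)

theorem HasIndex.wtIndex_eq {i : BlockIndex} (hM : HasIndex i M) {a c : ℂ} {v : M}
    (hv : IsSingular a c v) (h0 : v ≠ 0) : wtIndex (wt a c) = i := by
  rw [← blockIndex_singular]
  exact hM _ ((Submodule.ne_bot_iff _).2 ⟨v, hv.mem_primary, h0⟩)

theorem HasIndex.hom_eq_zero {i j : BlockIndex} (hM : HasIndex i M) (hN : HasIndex j N)
    (hb : borelFinite M = ⊤) (hij : i ≠ j) (φ : M →ₗ[U] N) : φ = 0 := by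
  have h1 : (⊤ : Submodule ℂ M) ≤ LinearMap.ker (φ.restrictScalars ℂ) := by
    rw [← iSup_primary hb]
    refine iSup_le fun x v hv => ?_
    by_contra hne
    have h2 : φ v ≠ 0 := hne
    refine hij ((hM x ?_).symm.trans (hN x ?_))
    · exact (Submodule.ne_bot_iff _).2 ⟨v, hv, fun h => h2 (by rw [h, map_zero])⟩
    · exact (Submodule.ne_bot_iff _).2 ⟨φ v, map_mem_primary φ hv, h2⟩
  ext v
  exact h1 (x := v) trivial

theorem hasIndex_vermaModule (lam : Weight) : HasIndex (wtIndex lam) (vermaModule lam) := by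
  rintro ⟨a, c, d⟩ hx
  obtain ⟨⟨n, hn⟩, hc, hd⟩ :=
    (isSingular_vermaGen lam).eq_of_primary_ne_bot (vermaGen_generates lam) hx
  simp only at hn hc hd
  subst hc hd
  rw [wtIndex, hn]
  convert blockIndex_add (lam hC) _ _ (-n) using 3
  push_cast
  ring

theorem primary_shift {a c d : ℂ} {v : M} (hv : v ∈ primary M (a, c, d)) :
    ∀ x ∈ stdBasis, ∃ n : ℤ, inU x • v ∈ primary M (a + 2 * n, c, d) := by
  have key : ∀ x ∈ stdBasis, ∀ n : ℤ, ∀ b : ℂ, b = a + 2 * n →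
      inU x • v ∈ (act M h).maxGenEigenspace b →
      ∃ n : ℤ, inU x • v ∈ primary M (a + 2 * n, c, d) := by
    rintro x hx n b rfl hb
    exact ⟨n, ⟨hb, hbar_maxGenEigenspace_stable c x hx v hv.1.2⟩,
      casimir_maxGenEigenspace_stable d x hv.2⟩
  obtain ⟨h1, h2, h3, h4, h5, h6⟩ := h_maxGenEigenspace_shift hv.1.1
  apply forall_stdBasis
  · exact key e (by simp [stdBasis]) 1 _ (by simp) h1
  · exact key f (by simp [stdBasis]) (-1) _ (by simp) h2
  · exact key h (by simp [stdBasis]) 0 _ (by simp) h3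
  · exact key ebar (by simp [stdBasis]) 1 _ (by simp) h4
  · exact key fbar (by simp [stdBasis]) (-1) _ (by simp) h5
  · exact key hbar (by simp [stdBasis]) 0 _ (by simp) h6

/-- The sum of the generalized eigenspaces belonging to the block `i`. -/
def partSpace (M : ModuleCat.{0} U) (i : BlockIndex) : Submodule ℂ M :=
  ⨆ x ∈ {x | blockIndex x = i}, primary M x

theorem primary_le_partSpace (x : ℂ × ℂ × ℂ) : primary M x ≤ partSpace M (blockIndex x) :=
  le_iSup₂_of_le (f := fun y (_ : y ∈ {y | blockIndex y = blockIndex x}) => primary M y) x rfl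
    le_rfl

theorem partSpace_stable (i : BlockIndex) :
    ∀ x ∈ stdBasis, ∀ v ∈ partSpace M i, inU x • v ∈ partSpace M i := by
  intro x hx v hv
  have h1 : partSpace M i ≤ (partSpace M i).comap (act M x) := by
    refine iSup₂_le fun y hy w hw => ?_
    obtain ⟨n, hn⟩ := primary_shift hw x hx
    have h2 := primary_le_partSpace _ hn
    rw [blockIndex_add, show blockIndex (y.1, y.2.1, y.2.2) = i from hy] at h2
    exact h2
  exact h1 hv

/-- The component of `M` in the block `i`. -/
def part (M : ModuleCat.{0} U) (i : BlockIndex) : Submodule U M :=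
  toUSubmodule (partSpace M i) (partSpace_stable i)

theorem hasIndex_part (i : BlockIndex) : HasIndex i (ModuleCat.of U (part M i)) := by
  intro x hx
  by_contra hne
  obtain ⟨v, hv, h0⟩ := Submodule.exists_mem_ne_zero_of_ne_bot hx
  have h1 := map_mem_primary (M := ModuleCat.of U (part M i)) (part M i).subtype hv
  have h2 := (iSupIndep_primary M).disjoint_biSup (x := x) (y := {x | blockIndex x = i}) hne
  exact h0 (Subtype.ext (Submodule.disjoint_def.1 h2 _ h1 v.2))

theorem iSupIndep_part (M : ModuleCat.{0} U) : iSupIndep (part M) := by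
  have h1 : iSupIndep (partSpace M) := iSupIndep_fiber (iSupIndep_primary M) blockIndex
  intro i
  rw [Submodule.disjoint_def]
  intro v hv hv'
  refine Submodule.disjoint_def.1 (h1 i) v hv ?_
  have hst : ∀ x ∈ stdBasis, ∀ v ∈ ⨆ j, ⨆ (_ : j ≠ i), partSpace M j,
      inU x • v ∈ ⨆ j, ⨆ (_ : j ≠ i), partSpace M j := by
    intro x hx v hv
    have h2 : ⨆ j, ⨆ (_ : j ≠ i), partSpace M j ≤
        (⨆ j, ⨆ (_ : j ≠ i), partSpace M j).comap (act M x) :=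
      iSup₂_le fun j hj w hw => le_iSup₂ (f := fun j (_ : j ≠ i) => partSpace M j) j hj
        (partSpace_stable j x hx w hw)
    exact h2 hv
  have h3 : ⨆ j, ⨆ (_ : j ≠ i), part M j ≤ toUSubmodule _ hst :=
    iSup₂_le fun j hj w hw => le_iSup₂ (f := fun j (_ : j ≠ i) => partSpace M j) j hj hw
  exact h3 hv'

theorem iSup_part (hM : borelFinite M = ⊤) : ⨆ i, part M i = ⊤ := by
  have hle : ∀ i, partSpace M i ≤ (⨆ i, part M i).restrictScalars ℂ := fun i v hv =>
    le_iSup (part M) i hv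
  have h1 : (⊤ : Submodule ℂ M) ≤ (⨆ i, part M i).restrictScalars ℂ := by
    rw [← iSup_primary hM]
    exact iSup_le fun x => (primary_le_partSpace x).trans (hle _)
  rw [eq_top_iff]
  intro v _
  exact h1 trivial

end BlockIndices

/-! ### The blocks of the theorem in terms of indices -/

section Characterization

variable {X : ObjectProperty (ModuleCat.{0} U)}

theorem exists_primary_ne_bot (hM : borelFinite M = ⊤) {a c : ℂ} (hac : wtSpace M a c ≠ ⊥) :
    ∃ d, primary M (a, c, d) ≠ ⊥ := by
  by_contra! hne
  have h1 := wtSpace_le_iSup_primary hM a c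
  simp_rw [hne, iSup_bot] at h1
  exact hac (le_bot_iff.1 h1)

theorem IsCategoryO.borelFinite (hX : IsCategoryO X) (hM : X M) : borelFinite M = ⊤ :=
  (thickO_iff.1 (hX.thick hM)).2

theorem IsCategoryO.finite (hX : IsCategoryO X) (hM : X M) : Module.Finite U M :=
  (thickO_iff.1 (hX.thick hM)).1

/-- For `c = 0` the index ignores the Casimir eigenvalue, so the support decides; conversely every
weight of the support occurs with some Casimir eigenvalue. -/
theorem cosetBlock_iff (hX : IsCategoryO X) (xi : Coset) :
    cosetBlock X xi M ↔ X M ∧ HasIndex (Sum.inr xi) M := by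
  refine and_congr_right fun hM => ⟨fun hs => ?_, fun hi => ?_⟩
  · rintro ⟨a, c, d⟩ hx
    obtain ⟨mu, hmu, hxi⟩ := hs (wt a c) (by
      change genWeightSpace M (wt a c) ≠ ⊥
      rw [genWeightSpace_eq, wt_hC, wt_hbarC]
      exact ne_bot_of_le_ne_bot hx inf_le_left)
    have hc : c = 0 := by
      have h1 : (mu : Weight) hbarC = 0 := mu.2
      rwa [hmu, wt_hbarC] at h1
    subst hc
    rw [blockIndex_zero, ← hxi]
    congr 2
    exact Subtype.ext hmu.symm
  · intro lam hlam
    have hlam' : genWeightSpace M lam ≠ ⊥ := hlam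
    rw [genWeightSpace_eq] at hlam'
    obtain ⟨d, hd⟩ := exists_primary_ne_bot (hX.borelFinite hM) hlam'
    have h1 := hi _ hd
    by_cases hc : lam hbarC = 0
    · refine ⟨⟨lam, hc⟩, rfl, ?_⟩
      rw [hc, blockIndex_zero, Sum.inr.injEq] at h1
      rw [← h1]
      congr 1
      refine Subtype.ext (weight_ext ?_ ?_)
      · exact (wt_hC _ _).symm
      · exact hc.trans (wt_hbarC _ _).symm
    · rw [blockIndex_of_ne hc] at h1
      cases h1

theorem hasIndex_of_equiv_L {lam : Weight} (hlam : lam hbarC ≠ 0) (φ : M ≃ₗ[U] L lam) :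
    HasIndex (Sum.inl ⟨lam, hlam⟩) M := by
  obtain ⟨ψ⟩ := nonempty_verma_equiv_L hlam
  rw [← wtIndex_of_ne hlam]
  exact (hasIndex_vermaModule lam).of_injective (φ := (φ.trans ψ.symm).toLinearMap)
    (φ.trans ψ.symm).injective

theorem exists_isSingular_of_hasIndex (hM : borelFinite M = ⊤) [Nontrivial M] {lam : Weight}
    (hlam : lam hbarC ≠ 0) (hi : HasIndex (Sum.inl ⟨lam, hlam⟩) M) :
    ∃ w : M, w ≠ 0 ∧ IsSingular (lam hC) (lam hbarC) w := by
  obtain ⟨a, c, w, hw, hs⟩ := exists_isSingular_of_nontrivial hM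
  have h1 := hi.wtIndex_eq hs hw
  rw [← wtIndex_of_ne hlam] at h1
  have h2 : wt a c = lam := by
    rcases eq_or_of_wtIndex_eq h1 with h2 | ⟨-, h3, -⟩
    · exact h2
    · exact absurd h3 hlam
  refine ⟨w, hw, ?_⟩
  rw [← h2, wt_hC, wt_hbarC]
  exact hs

/-- If an index occurs in `M`, the corresponding component has a simple quotient of that index,
which is `L lam` by hypothesis. Conversely a simple subquotient inherits the index, so its singular
vector has weight `lam` and Schur's lemma identifies it with `L lam`. -/
theorem easyBlock_iff (hX : IsCategoryO X) {lam : Weight} (hlam : lam hbarC ≠ 0) :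
    easyBlock X lam M ↔ X M ∧ HasIndex (Sum.inl ⟨lam, hlam⟩) M := by
  refine and_congr_right fun hM => ⟨fun hs => ?_, fun hi => ?_⟩
  · intro x hx
    have hb := hX.borelFinite hM
    have := hX.finite hM
    have hnoeth := isNoetherian_of_borelFinite hb
    set P := part M (blockIndex x) with hP
    have hPX : X (ModuleCat.of U P) :=
      hX.of_injective (M := ModuleCat.of U P) P.subtype P.injective_subtype hM
    have hPnt : Nontrivial P := by
      obtain ⟨v, hv, h0⟩ := Submodule.exists_mem_ne_zero_of_ne_bot hx
      exact Submodule.nontrivial_iff_ne_bot.2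
        ((Submodule.ne_bot_iff _).2 ⟨v, primary_le_partSpace x hv, h0⟩)
    obtain ⟨K, hK, -⟩ := (eq_top_or_exists_le_coatom (⊥ : Submodule U P)).resolve_left bot_ne_top
    -- The maximal submodule `K` of `P` is regarded inside `M`, because the subquotients in
    -- `easyBlock` are formed from two submodules of `M`.
    have hKP : (K.map P.subtype).submoduleOf P = K :=
      Submodule.comap_map_eq_of_injective P.injective_subtype K
    have hsimple : IsSimpleModule U (P ⧸ (K.map P.subtype).submoduleOf P) := by
      rw [hKP]
      exact isSimpleModule_iff_isCoatom.2 hK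
    obtain ⟨φ⟩ := hs _ _ hsimple
    have hnt : Nontrivial (ModuleCat.of U (P ⧸ (K.map P.subtype).submoduleOf P)) :=
      IsSimpleModule.nontrivial U (P ⧸ (K.map P.subtype).submoduleOf P)
    have hPb := hX.borelFinite hPX
    have hQ : HasIndex (blockIndex x) (ModuleCat.of U (P ⧸ (K.map P.subtype).submoduleOf P)) :=
      (hasIndex_part (blockIndex x)).of_surjective hPb
        (φ := ((K.map P.subtype).submoduleOf P).mkQ) (Submodule.mkQ_surjective _)
    have hQb : borelFinite (ModuleCat.of U (P ⧸ (K.map P.subtype).submoduleOf P)) = ⊤ :=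
      borelFinite_eq_top_of_surjective (M := ModuleCat.of U P)
        (φ := ((K.map P.subtype).submoduleOf P).mkQ) (Submodule.mkQ_surjective _) hPb
    obtain ⟨a, c, w, hw, hsing⟩ := exists_isSingular_of_nontrivial hQb
    rw [← hQ.wtIndex_eq hsing hw]
    exact (hasIndex_of_equiv_L (M := ModuleCat.of U (P ⧸ (K.map P.subtype).submoduleOf P)) hlam
      φ).wtIndex_eq hsing hw
  · intro K P hsimple
    have hPX : X (ModuleCat.of U P) :=
      hX.of_injective (M := ModuleCat.of U P) P.subtype P.injective_subtype hM
    have hPi : HasIndex _ (ModuleCat.of U P) :=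
      hi.of_injective (φ := P.subtype) P.injective_subtype
    have hPb := hX.borelFinite hPX
    have hQ := hPi.of_surjective (N := ModuleCat.of U (P ⧸ K.submoduleOf P)) hPb
      (φ := (K.submoduleOf P).mkQ) (Submodule.mkQ_surjective _)
    have hQb : borelFinite (ModuleCat.of U (P ⧸ K.submoduleOf P)) = ⊤ :=
      borelFinite_eq_top_of_surjective (M := ModuleCat.of U P)
        (φ := (K.submoduleOf P).mkQ) (Submodule.mkQ_surjective _) hPb
    have hnt : Nontrivial (ModuleCat.of U (P ⧸ K.submoduleOf P)) :=
      IsSimpleModule.nontrivial U (P ⧸ K.submoduleOf P)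
    obtain ⟨w, hw, hsing⟩ := exists_isSingular_of_hasIndex hQb hlam hQ
    have hsimple' : IsSimpleModule U (ModuleCat.of U (P ⧸ K.submoduleOf P)) := hsimple
    exact nonempty_equiv_L_of_isSingular hlam hsing hw

theorem block_iff (hX : IsCategoryO X) (i : BlockIndex) : block X i M ↔ X M ∧ HasIndex i M := by
  obtain ⟨lam, hlam⟩ | xi := i
  · exact easyBlock_iff hX hlam
  · exact cosetBlock_iff hX xi

end Characterization

end

end Takiff

namespace Takiff

noncomputable section

open scoped ModuleCat

open Module.End

variable {M N : ModuleCat.{0} U} {X : ObjectProperty (ModuleCat.{0} U)}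

/-! ### The blocks are abelian subcategories -/

section Abelian

theorem block_of_injective (hX : IsCategoryO X) {i : BlockIndex} (φ : M →ₗ[U] N)
    (hφ : Function.Injective φ) (hN : block X i N) : block X i M := by
  rw [block_iff hX] at hN ⊢
  exact ⟨hX.of_injective φ hφ hN.1, hN.2.of_injective hφ⟩

theorem block_of_surjective (hX : IsCategoryO X) {i : BlockIndex} (φ : M →ₗ[U] N)
    (hφ : Function.Surjective φ) (hM : block X i M) : block X i N := by
  rw [block_iff hX] at hM ⊢
  exact ⟨hX.of_surjective φ hφ hM.1, hM.2.of_surjective (hX.borelFinite hM.1) hφ⟩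

theorem block_pi (hX : IsCategoryO X) {i : BlockIndex} {J : Type} [Finite J]
    (A : J → ModuleCat.{0} U) (hA : ∀ j, block X i (A j)) :
    block X i (ModuleCat.of U (∀ j, A j)) := by
  rw [block_iff hX]
  exact ⟨hX.pi A fun j => ((block_iff hX i).1 (hA j)).1,
    HasIndex.pi fun j => ((block_iff hX i).1 (hA j)).2⟩

theorem block_vermaModule (hX : IsCategoryO X) (lam : Weight) :
    block X (wtIndex lam) (vermaModule lam) :=
  (block_iff hX _).2 ⟨hX.of_classical classicalO_vermaModule, hasIndex_vermaModule lam⟩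

theorem of_iso (hX : IsCategoryO X) (φ : M ≅ N) (hM : X M) : X N :=
  hX.of_surjective φ.toLinearEquiv.toLinearMap φ.toLinearEquiv.surjective hM

theorem isAbelianSubcategory_block (hX : IsCategoryO X) (i : BlockIndex) :
    IsAbelianSubcategory (block X i) := by
  have hsub : (block X i).IsClosedUnderSubobjects :=
    ⟨fun g hg hN => block_of_injective hX g.hom ((ModuleCat.mono_iff_injective g).1 hg) hN⟩
  have hquot : (block X i).IsClosedUnderQuotients :=
    ⟨fun g hg hM => block_of_surjective hX g.hom ((ModuleCat.epi_iff_surjective g).1 hg) hM⟩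
  -- Kernels are subobjects and cokernels are quotients, so `hsub` and `hquot` settle them.
  refine ⟨⟨?_⟩, inferInstance, ?_, inferInstance, inferInstance⟩
  · obtain ⟨lam, rfl⟩ := wtIndex_surjective i
    refine ⟨ModuleCat.of U PUnit, ModuleCat.isZero_of_subsingleton _, ?_⟩
    exact block_of_injective hX (M := ModuleCat.of U PUnit) 0 (Function.injective_of_subsingleton _)
      (block_vermaModule hX lam)
  · refine ⟨fun J _ => ⟨?_⟩⟩
    rintro Z ⟨p⟩
    let A : J → ModuleCat.{0} U := fun j => p.diag.obj ⟨j⟩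
    let g : Z ⟶ ModuleCat.of U (∀ j, A j) :=
      ModuleCat.ofHom (LinearMap.pi fun j => (p.π.app ⟨j⟩).hom)
    -- The projections separate maps into the limit `Z`, so `Z` embeds into the module of families.
    have hg : Mono g := by
      refine ⟨fun k l hkl => p.isLimit.hom_ext ?_⟩
      rintro ⟨j⟩
      have h1 : g ≫ ModuleCat.ofHom (LinearMap.proj j : (∀ j, A j) →ₗ[U] A j) = p.π.app ⟨j⟩ := rfl
      change k ≫ p.π.app ⟨j⟩ = l ≫ p.π.app ⟨j⟩
      rw [← h1, ← Category.assoc, hkl, Category.assoc]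
    exact hsub.prop_of_mono g (block_pi hX A fun j => p.prop_diag_obj ⟨j⟩)

end Abelian

/-! ### The direct sum decomposition -/

section DirectSumDecomposition

theorem isDirectSumOfSubcategories_block (hX : IsCategoryO X) :
    IsDirectSumOfSubcategories X (block X) where
  hom_eq_zero i j hij A B hA hB g := by
    rw [block_iff hX] at hA hB
    ext1
    exact hA.2.hom_eq_zero hB.2 (hX.borelFinite hA.1) hij g.hom
  mem_iff M := by
    classical
    constructor
    · intro hM
      have hb := hX.borelFinite hM
      have := hX.finite hM
      have hnoeth := isNoetherian_of_borelFinite hb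
      -- In a Noetherian module only finitely many independent submodules are nonzero.
      have hfin := Submodule.finite_ne_bot_of_iSupIndep (iSupIndep_part M)
      let s : Finset BlockIndex := hfin.toFinset
      refine ⟨s, fun i => ModuleCat.of U (part M i), fun i => ?_, ?_⟩
      · rw [block_iff hX]
        exact ⟨hX.of_injective (M := ModuleCat.of U (part M i)) (part M i).subtype
          (part M i).injective_subtype hM, hasIndex_part _⟩
      · have hind : iSupIndep fun i : s => part M i :=
          (iSupIndep_part M).comp Subtype.val_injective
        have htop : ⨆ i : s, part M i = ⊤ := by
          rw [eq_top_iff, ← iSup_part hb]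
          refine iSup_le fun i => ?_
          by_cases hi : part M i = ⊥
          · rw [hi]
            exact bot_le
          · exact le_iSup (fun i : s => part M i) ⟨i, hfin.mem_toFinset.2 hi⟩
        have hint := DirectSum.isInternal_submodule_of_iSupIndep_of_iSup_eq_top hind htop
        let φ : (∀ i : s, part M i) ≃ₗ[U] M :=
          (DirectSum.linearEquivFunOnFintype U s fun i => part M i).symm.trans
            (LinearEquiv.ofBijective (DirectSum.coeLinearMap fun i : s => part M i) hint)
        exact ⟨φ.symm.toModuleIso ≪≫
          (ModuleCat.biproductIsoPi fun i : s => ModuleCat.of U (part M i)).symm⟩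
    · rintro ⟨s, A, hA, ⟨φ⟩⟩
      refine of_iso hX ((ModuleCat.biproductIsoPi A).symm ≪≫ φ.symm) ?_
      exact hX.pi A fun i => ((block_iff hX _).1 (hA i)).1

end DirectSumDecomposition

/-! ### Indecomposability of the blocks -/

section Indecomposability

theorem vermaLift_ne_zero {lam : Weight} {v : M} (hv : IsSingular (lam hC) (lam hbarC) v)
    (h0 : v ≠ 0) : vermaLift hv ≠ 0 := by
  intro h
  have := vermaLift_vermaGen hv
  rw [h, LinearMap.zero_apply] at this
  exact h0 this.symm

theorem exists_hom_vermaModule_of_eq_sub {lam mu : Weight} (hlam : lam hbarC = 0)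
    (hmu : mu hbarC = 0) (n : ℕ) (hn : mu hC = lam hC - 2 * n) :
    ∃ φ : vermaModule mu →ₗ[U] vermaModule lam, φ ≠ 0 := by
  have h1 := isSingular_vermaGen lam
  rw [hlam] at h1
  have h2 := h1.fbar_pow_smul n
  rw [← hn, ← hmu] at h2
  exact ⟨vermaLift h2, vermaLift_ne_zero h2 (fbar_pow_smul_vermaGen_ne_zero n)⟩

theorem exists_hom_vermaModule {lam mu : Weight} (hlm : wtIndex lam = wtIndex mu) :
    (∃ φ : vermaModule mu →ₗ[U] vermaModule lam, φ ≠ 0) ∨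
      ∃ φ : vermaModule lam →ₗ[U] vermaModule mu, φ ≠ 0 := by
  rcases eq_or_of_wtIndex_eq hlm with rfl | ⟨h1, h2, n, hn⟩
  · refine Or.inl ⟨LinearMap.id, fun h => vermaGen_ne_zero (lam := lam) ?_⟩
    exact LinearMap.congr_fun h (vermaGen lam)
  · obtain ⟨k, rfl | rfl⟩ := Int.eq_nat_or_neg n
    · refine Or.inr (exists_hom_vermaModule_of_eq_sub h2 h1 k ?_)
      rw [hn]
      push_cast
      ring
    · refine Or.inl (exists_hom_vermaModule_of_eq_sub h1 h2 k ?_)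
      rw [hn]
      push_cast
      ring

/-- Verma modules are indecomposable. -/
theorem exists_iso_vermaModule {lam : Weight} {ι : Type} [Finite ι] {A : ι → ModuleCat.{0} U}
    (φ : vermaModule lam ≅ ⨁ A) : ∃ j, Nonempty (vermaModule lam ≅ A j) := by
  have := Fintype.ofFinite ι
  let inc : ∀ j, A j ⟶ vermaModule lam := fun j => biproduct.ι A j ≫ φ.inv
  let proj : ∀ j, vermaModule lam ⟶ A j := fun j => φ.hom ≫ biproduct.π A j
  have hsum : ∑ j, proj j ≫ inc j = 𝟙 (vermaModule lam) := by
    have h1 : ∀ j, proj j ≫ inc j = φ.hom ≫ (biproduct.π A j ≫ biproduct.ι A j) ≫ φ.inv := by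
      intro j
      simp [proj, inc]
    simp_rw [h1, ← Preadditive.comp_sum, ← Preadditive.sum_comp]
    have h2 := biproduct.total (f := A)
    simp [h2]
  have hv : ∑ j, (inc j).hom ((proj j).hom (vermaGen lam)) = vermaGen lam := by
    have h1 := congrArg (fun g : vermaModule lam ⟶ vermaModule lam => g.hom (vermaGen lam)) hsum
    simpa [ModuleCat.hom_sum] using h1
  -- Some summand has nonzero component of the generator. That component lies in the highest weight
  -- line, so the image of `inc j` contains the generator, and the split monomorphism `inc j` is
  -- onto.
  obtain ⟨j, -, hj⟩ := Finset.exists_ne_zero_of_sum_ne_zero (hv ▸ vermaGen_ne_zero (lam := lam))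
  refine ⟨j, ?_⟩
  have hmono : Mono (inc j) := by
    have h1 : inc j ≫ proj j = 𝟙 (A j) := by simp [proj, inc]
    exact (SplitMono.mk (proj j) h1).mono
  have hmem := map_mem_h_maxGenEigenspace ((inc j).hom ∘ₗ (proj j).hom)
    (isSingular_vermaGen lam).mem_wtSpace.1
  have hgen : vermaGen lam ∈ LinearMap.range (inc j).hom :=
    (isSingular_vermaGen lam).mem_of_mem (vermaGen_generates lam) hmem hj ⟨_, rfl⟩
  have hepi : Epi (inc j) :=
    (ModuleCat.epi_iff_surjective _).2
      (LinearMap.range_eq_top.1 (vermaGen_generates lam _ hgen))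
  have hiso : IsIso (inc j) := isIso_of_mono_of_epi _
  exact ⟨(asIso (inc j)).symm⟩

theorem nontrivial_of_not_isZero (hM : ¬ IsZero M) : Nontrivial M := by
  by_contra h
  have := not_nontrivial_iff_subsingleton.1 h
  exact hM (ModuleCat.isZero_of_subsingleton M)

theorem _root_.IsDirectSumOfSubcategories.summand_le {C : Type*} [Category C] [Preadditive C]
    [HasFiniteBiproducts C] {P : ObjectProperty C} {I : Type*} {Q : I → ObjectProperty C}
    (hQ : IsDirectSumOfSubcategories P Q) {i : I} {A : C} (hA : Q i A) : P A := by
  refine (hQ.mem_iff A).2 ⟨{i}, fun _ => A, ?_, ⟨(biproductUniqueIso fun _ => A).symm⟩⟩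
  rintro ⟨j, hj⟩
  obtain rfl := Finset.mem_singleton.1 hj
  exact hA

theorem isIndecomposableSubcategory_block (hX : IsCategoryO X) (i : BlockIndex) :
    IsIndecomposableSubcategory (block X i) := by
  constructor
  · obtain ⟨lam, rfl⟩ := wtIndex_surjective i
    refine ⟨_, block_vermaModule hX lam, fun h => ?_⟩
    have := ModuleCat.subsingleton_of_isZero h
    exact vermaGen_ne_zero (Subsingleton.elim (vermaGen lam) 0)
  · intro Q hQ
    -- A nonzero object of `Q k` forces a Verma module into `Q k`: a singular vector gives a nonzero
    -- map from a Verma module, which lies in a single summand, and that must be `Q k`.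
    have key : ∀ (k : Fin 2) (A : ModuleCat.{0} U), Q k A → ¬ IsZero A →
        ∃ (lam : Weight) (B : ModuleCat.{0} U), wtIndex lam = i ∧ Q k B ∧
          Nonempty (vermaModule lam ≅ B) := by
      intro k A hA h0
      have hAi := (block_iff hX i).1 (hQ.summand_le hA)
      have hnt := nontrivial_of_not_isZero h0
      obtain ⟨a, c, w, hw, hs⟩ := exists_isSingular_of_nontrivial (hX.borelFinite hAi.1)
      have hi := hAi.2.wtIndex_eq hs hw
      have hs' : IsSingular (wt a c hC) (wt a c hbarC) w := by
        rw [wt_hC, wt_hbarC]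
        exact hs
      obtain ⟨s, B, hB, ⟨φ⟩⟩ := (hQ.mem_iff (vermaModule (wt a c))).1
        (hi ▸ block_vermaModule hX (wt a c))
      obtain ⟨j, ⟨ψ⟩⟩ := exists_iso_vermaModule φ
      refine ⟨wt a c, B j, hi, ?_, ⟨ψ⟩⟩
      by_cases hjk : (j : Fin 2) = k
      · exact hjk ▸ hB j
      · exfalso
        have h1 := hQ.hom_eq_zero j k hjk _ _ (hB j) hA (ψ.inv ≫ ModuleCat.ofHom (vermaLift hs'))
        have h2 : ModuleCat.ofHom (vermaLift hs') = 0 := by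
          rw [← cancel_epi ψ.inv, h1, comp_zero]
        exact vermaLift_ne_zero hs' hw (congrArg ModuleCat.Hom.hom h2)
    have hzero : ∀ (k l : Fin 2), k ≠ l → ∀ (lam mu : Weight) (B C : ModuleCat.{0} U), Q k B →
        Q l C → (vermaModule lam ≅ B) → (vermaModule mu ≅ C) →
        ∀ φ : vermaModule lam →ₗ[U] vermaModule mu, φ = 0 := by
      intro k l hkl lam mu B C hB hC ψ χ φ
      have h1 := hQ.hom_eq_zero k l hkl _ _ hB hC (ψ.inv ≫ ModuleCat.ofHom φ ≫ χ.hom)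
      have h2 : ModuleCat.ofHom φ = 0 := by
        rw [← cancel_epi ψ.inv, ← cancel_mono χ.hom, Category.assoc, h1, comp_zero, zero_comp]
      exact congrArg ModuleCat.Hom.hom h2
    by_contra! hne
    obtain ⟨A₀, hA₀, h₀⟩ := hne 0
    obtain ⟨A₁, hA₁, h₁⟩ := hne 1
    obtain ⟨lam, B₀, hi₀, hB₀, ⟨ψ₀⟩⟩ := key 0 A₀ hA₀ h₀
    obtain ⟨mu, B₁, hi₁, hB₁, ⟨ψ₁⟩⟩ := key 1 A₁ hA₁ h₁
    rcases exists_hom_vermaModule (hi₀.trans hi₁.symm) with ⟨φ, hφ⟩ | ⟨φ, hφ⟩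
    · exact hφ (hzero 1 0 (by decide) mu lam B₁ B₀ hB₁ hB₀ ψ₁ ψ₀ φ)
    · exact hφ (hzero 0 1 (by decide) lam mu B₀ B₁ hB₀ hB₁ ψ₀ ψ₁ φ)

end Indecomposability

/-! ### Simple objects and supports for `lam(hbar) ≠ 0` -/

section EasyBlocks

variable {lam : Weight}

theorem isSimpleModule_L (hlam : lam hbarC ≠ 0) : IsSimpleModule U (L lam) := by
  obtain ⟨φ⟩ := nonempty_verma_equiv_L hlam
  have := isSimpleModule_verma hlam
  exact IsSimpleModule.congr φ.symm

theorem easyBlock_L (hlam : lam hbarC ≠ 0) (hX : IsCategoryO X) : easyBlock X lam (L lam) := by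
  obtain ⟨φ⟩ := nonempty_verma_equiv_L hlam
  refine (easyBlock_iff hX hlam).2 ⟨?_, hasIndex_of_equiv_L hlam (LinearEquiv.refl U _)⟩
  exact hX.of_surjective φ.toLinearMap φ.surjective (hX.of_classical classicalO_vermaModule)

theorem nonempty_iso_L (hlam : lam hbarC ≠ 0) (hX : IsCategoryO X) (hM : easyBlock X lam M)
    (hs : IsSimpleModule U M) : Nonempty (M ≅ L lam) := by
  rw [easyBlock_iff hX hlam] at hM
  have hnt : Nontrivial M := IsSimpleModule.nontrivial U M
  obtain ⟨w, hw, hsing⟩ := exists_isSingular_of_hasIndex (hX.borelFinite hM.1) hlam hM.2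
  obtain ⟨φ⟩ := nonempty_equiv_L_of_isSingular hlam hsing hw
  exact ⟨φ.toModuleIso⟩

/-- A weight vector can be raised to a singular vector, whose weight must be `lam`; conversely the
powers of `fbar` never kill a singular vector of weight `lam`. -/
theorem supp_eq_of_easyBlock (hlam : lam hbarC ≠ 0) (hX : IsCategoryO X)
    (hM : easyBlock X lam M) (h0 : ¬ IsZero M) :
    supp M = Set.range fun n : ℕ => lam - n • alpha := by
  rw [easyBlock_iff hX hlam] at hM
  have hnt := nontrivial_of_not_isZero h0
  have hb := hX.borelFinite hM.1
  have hval : ∀ n : ℕ, (lam - n • alpha) hC = lam hC - 2 * n ∧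
      (lam - n • alpha) hbarC = lam hbarC := by
    intro n
    rw [LinearMap.sub_apply, LinearMap.sub_apply, LinearMap.smul_apply, LinearMap.smul_apply,
      alpha_hC, alpha_hbarC, nsmul_eq_mul, smul_zero, sub_zero]
    exact ⟨by ring, rfl⟩
  ext mu
  change genWeightSpace M mu ≠ ⊥ ↔ _
  rw [genWeightSpace_eq]
  constructor
  · intro hmu
    obtain ⟨v, hv, hv0⟩ := Submodule.exists_mem_ne_zero_of_ne_bot hmu
    obtain ⟨n, w, hw, hs⟩ := exists_isSingular hv (hb ▸ trivial) hv0
    have h1 := hM.2.wtIndex_eq hs hw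
    rw [← wtIndex_of_ne hlam] at h1
    have h2 : wt (mu hC + 2 * n) (mu hbarC) = lam := by
      rcases eq_or_of_wtIndex_eq h1 with h2 | ⟨-, h3, -⟩
      · exact h2
      · exact absurd h3 hlam
    refine ⟨n, weight_ext ?_ ?_⟩
    · rw [(hval n).1, ← h2, wt_hC]
      ring
    · rw [(hval n).2, ← h2, wt_hbarC]
  · rintro ⟨n, rfl⟩
    obtain ⟨w, hw, hsing⟩ := exists_isSingular_of_hasIndex hb hlam hM.2
    rw [(hval n).1, (hval n).2]
    exact (Submodule.ne_bot_iff _).2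
      ⟨_, hsing.fbar_pow_smul_mem n, hsing.fbar_pow_smul_ne_zero hlam hw n⟩

end EasyBlocks

end

end Takiff

/-- For `X` classical or thick category `𝒪` of Takiff `sl₂`, `X` is the direct sum of the
indecomposable abelian subcategories `X(lam)`, `lam(hbar) ≠ 0`, and `X(ξ)`, `ξ` a coset of `ℤα`;
and `L(lam)` is the only simple object of `X(lam)`, all of whose nonzero objects have support
`{lam - n α | n ≥ 0}`. -/
theorem theorem9 (X : ObjectProperty (ModuleCat.{0} Takiff.U))
    (hX : X = Takiff.classicalO ∨ X = Takiff.thickO) :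
    IsDirectSumOfSubcategories X (Takiff.block X) ∧
    (∀ i : Takiff.BlockIndex,
      IsAbelianSubcategory (Takiff.block X i) ∧ IsIndecomposableSubcategory (Takiff.block X i)) ∧
    (∀ lam : Takiff.Weight, lam Takiff.hbarC ≠ 0 →
      IsSimpleModule Takiff.U (Takiff.L lam) ∧
      Takiff.easyBlock X lam (Takiff.L lam) ∧
      (∀ S : ModuleCat.{0} Takiff.U, Takiff.easyBlock X lam S → IsSimpleModule Takiff.U S →
        Nonempty (S ≅ Takiff.L lam)) ∧
      (∀ M : ModuleCat.{0} Takiff.U, Takiff.easyBlock X lam M → ¬ IsZero M →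
        Takiff.supp M = Set.range fun n : ℕ => lam - n • Takiff.alpha)) := by
  have h : Takiff.IsCategoryO X := by
    rcases hX with rfl | rfl
    exacts [Takiff.isCategoryO_classicalO, Takiff.isCategoryO_thickO]
  exact ⟨Takiff.isDirectSumOfSubcategories_block h,
    fun i => ⟨Takiff.isAbelianSubcategory_block h i, Takiff.isIndecomposableSubcategory_block h i⟩,
    fun lam hlam => ⟨Takiff.isSimpleModule_L hlam, Takiff.easyBlock_L hlam h,
      fun S hS hs => Takiff.nonempty_iso_L hlam h hS hs,
      fun M hM h0 => Takiff.supp_eq_of_easyBlock hlam h hM h0⟩⟩
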